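/- Let $Q$ be an $n$-dimensional affine manifold (Hausdorff, second countable, without boundary; transition maps locally affine) with a full-rank lattice $N_Q\subset TQ$ and a Riemannian metric $g$, both constant in affine charts. Let $M_Q=N_Q^*\subset T^*Q$ be the dual lattice, $X^A=T^*Q/M_Q$ with the canonical symplectic form $\omega=\sum_i dq_i\wedge dp_i$, and $\pi_A:X^A\to Q$ the Lagrangian torus fibration. The flat connection gives a splitting $TX^A=\pi_A^*TQ\oplus\pi_A^*T^*Q$. Let $\Phi:T^*Q\to TQ$ be the isomorphism given by $g$; for $A>0$ let $I_A$ be the $\omega$-compatible almost complex structure $I_A(v,\alpha)=(-A^{-1}\Phi\alpha,\,A\Phi^{-1}v)$, i.e. $I_A\partial_{q_i}=A\,\partial_{p_i}$, $I_A\partial_{p_i}=-A^{-1}\partial_{q_i}$ in orthonormal affine coordinates. Let $V\subset Q$ be a tropical subvariety, that is, a locally finite regular rational polyhedral complex with closed, possibly unbounded cells (the balancing condition is not needed), with support $|V|$. Let $B_\varepsilon(|V|)$ be the open $\varepsilon$-neighbourhood of $|V|$ for the distance of $g$, where $\varepsilon>0$ is such that the inclusion $|V|\hookrightarrow B_\varepsilon(|V|)$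 is a homotopy equivalence. Let $L_V\subset X^A$ be an embedded Lagrangian submanifold with $\pi_A(L_V)\subset B_\varepsilon(|V|)$; this is all that is required of a Lagrangian lift of $V$ here. Assume that $L_V$ is compact or, more generally, that there is $\rho>0$ such that every point of $\pi_A(L_V)$ is the centre of an isometrically embedded flat ball of radius $\rho$ contained in $B_\varepsilon(|V|)$. Write $\pi_V:L_V\to B_\varepsilon(|V|)\simeq|V|$ for $\pi_A$ followed by a homotopy inverse of the inclusion, and $(\pi_V)_*:H_1(L_V;\mathbb Z)\to H_1(|V|;\mathbb Z)$ for the induced map. For a family $\{J_E\}_{E>0}$ of almost complex structures on $X^A$, let the limit loop grading group $\mathrm{Grd}_\infty(L_V,\{J_E\})\subset H_1(L_V;\mathbb Z)$ be the subgroup generated by the classes $[\partial u]$ of all $J_E$-holomorphic disks $u:(D^2,\partial D^2)\to(X^A,L_V)$, smooth on the closed disk, with $\int_{D^2}u^*\omega\le E$, for all $E>0$. **Lemma.** There is a family $\{J_E\}_{E>0}$ of $\omega$-compatible almost complex structures, each of the form $J_E=I_{A}$ for some $A=A(E)>0$, such that $$\mathrm{Grd}_\infty(L_V,\{J_E\})\subset\ker\big((\pi_V)_*:H_1(L_V;\mathbb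 Z)\to H_1(|V|;\mathbb Z)\big).$$ -/

import Mathlib

open Bundle Topology MeasureTheory
open scoped Manifold ContDiff

noncomputable section

namespace Trop

/-! ### Integral affine manifolds with an affine metric -/

/-- Coordinate space `ℝⁿ`. -/
abbrev EE (n : ℕ) : Type := EuclideanSpace ℝ (Fin n)

/-- An affine manifold: a smooth manifold with an atlas whose transition maps are locally affine. -/
class AffineManifold (n : ℕ) (Q : Type) [TopologicalSpace Q] [ChartedSpace (EE n) Q] : Prop
    extends IsManifold (𝓡 n) ∞ Q where
  affine_transition : ∀ e ∈ atlas (EE n) Q, ∀ e' ∈ atlas (EE n) Q,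
    ∀ x ∈ (e.symm.trans e').source,
      ∃ a : EE n →ᵃ[ℝ] EE n, ∀ᶠ y in 𝓝 x, (e.symm.trans e') y = a y

section

variable (n : ℕ) {Q : Type} [TopologicalSpace Q] [ChartedSpace (EE n) Q] [AffineManifold n Q]

/-- The tangent space `T_q Q`; it is `ℝⁿ`, read in the preferred affine chart at `q`. -/
abbrev Tan (q : Q) : Type := TangentSpace (𝓡 n) q

/-- The cotangent space `T*_q Q`, read in the preferred affine chart at `q`. -/
abbrev Cot : Type := EE n →L[ℝ] ℝ

/-- Flat transport `T_q Q → T_{q'} Q` for `q'` near `q`: it sends a vector to the vector with the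
same components in the affine chart `chartAt q`. -/
def transport (q q' : Q) : EE n →L[ℝ] EE n := tangentCoordChange (𝓡 n) q q' q'

/-- The inverse `T_{q'} Q → T_q Q` of the flat transport, for `q'` near `q`: the components of a
vector at `q'` in the affine chart `chartAt q`. -/
def transportInv (q q' : Q) : EE n →L[ℝ] EE n := tangentCoordChange (𝓡 n) q' q q'

/-- An integral structure and an affine Riemannian metric on an affine manifold `Q`: a full-rank
lattice `N_Q ⊂ TQ` and a Riemannian metric `g`, both constant in affine charts. -/
structure IntegralMetric (Q : Type) [TopologicalSpace Q] [ChartedSpace (EE n) Q]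
    [AffineManifold n Q] where
  N : ∀ q : Q, AddSubgroup (Tan n q)
  N_basis : ∀ q, ∃ b : Module.Basis (Fin n) ℝ (Tan n q), N q = AddSubgroup.closure (Set.range b)
  N_flat : ∀ q : Q, ∀ᶠ q' in 𝓝 q, ∀ v : EE n, transport n q q' v ∈ N q' ↔ v ∈ N q
  g : ContMDiffRiemannianMetric (𝓡 n) ∞ (EE n) (fun q : Q => TangentSpace (𝓡 n) q)
  g_flat : ∀ q : Q, ∀ᶠ q' in 𝓝 q, ∀ v w : EE n,
    g.inner q' (transport n q q' v) (transport n q q' w) = g.inner q v w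

/-- The cotangent bundle `T*Q`, with its bundle topology and smooth structure. -/
abbrev CotBundle (Q : Type) [TopologicalSpace Q] [ChartedSpace (EE n) Q] [AffineManifold n Q] :
    Type :=
  TotalSpace (EE n →L[ℝ] ℝ) (fun q : Q => TangentSpace (𝓡 n) q →L[ℝ] Trivial Q ℝ q)

/-- The model with corners of the manifold `T*Q`. -/
abbrev CotModel : ModelWithCorners ℝ (EE n × (EE n →L[ℝ] ℝ)) (ModelProd (EE n) (EE n →L[ℝ] ℝ)) :=
  (𝓡 n).prod 𝓘(ℝ, EE n →L[ℝ] ℝ)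

/-- The space `T_q Q ⊕ T*_q Q`, which is the tangent space of `X^A = T*Q / M_Q` (and of `T*Q`) at
each point over `q`, by the splitting `T X^A = π_A^* TQ ⊕ π_A^* T*Q` of the flat (Levi-Civita)
connection. It is read in the preferred affine chart at `q`. -/
abbrev TX : Type := EE n × (EE n →L[ℝ] ℝ)

/-- The canonical symplectic form `∑ dqᵢ ∧ dpᵢ`. -/
def omega (ξ η : TX n) : ℝ := η.2 ξ.1 - ξ.2 η.1

/-- The splitting on the cover `T*Q`. The tangent space at `x` is read in the chart of `T*Q`
induced by the preferred affine chart of `Q` at `x.proj`, so that the splitting is the identity. -/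
def split (x : CotBundle n Q) (ξ : TangentSpace (CotModel n) x) : TX n := ξ

/-- Components in the affine chart `chartAt q` of an element of `T_{q'} Q ⊕ T*_{q'} Q`, for `q'`
near `q`. -/
def toChart (q q' : Q) : TX n →L[ℝ] TX n :=
  ((transportInv n q q').comp (ContinuousLinearMap.fst ℝ _ _)).prod
    (((ContinuousLinearMap.compL ℝ (EE n) (EE n) ℝ).flip (transport n q q')).comp
      (ContinuousLinearMap.snd ℝ _ _))

/-- The element of `T_{q'} Q ⊕ T*_{q'} Q` with given components in `chartAt q`. -/
def ofChart (q q' : Q) : TX n →L[ℝ] TX n :=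
  ((transport n q q').comp (ContinuousLinearMap.fst ℝ _ _)).prod
    (((ContinuousLinearMap.compL ℝ (EE n) (EE n) ℝ).flip (transportInv n q q')).comp
      (ContinuousLinearMap.snd ℝ _ _))

end

namespace IntegralMetric

variable {n : ℕ} {Q : Type} [TopologicalSpace Q] [ChartedSpace (EE n) Q] [AffineManifold n Q]
  (G : IntegralMetric n Q)

/-! ### Metric notions on the base -/

/-- The Riemannian distance of `g`. -/
def dist (x y : Q) : ENNReal :=
  letI : RiemannianBundle (fun q : Q => TangentSpace (𝓡 n) q) := ⟨G.g.toRiemannianMetric⟩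
  Manifold.riemannianEDist (𝓡 n) x y

/-- The open neighbourhood `B_ε(S)` of a subset of `Q`. -/
def thickening (S : Set Q) (ε : ℝ) : Set Q :=
  {q | ∃ x ∈ S, G.dist x q < ENNReal.ofReal ε}

/-- `q` is the centre of an isometrically embedded Euclidean ball of radius `ρ` contained in `S`. -/
def HasFlatBall (q : Q) (ρ : ℝ) (S : Set Q) : Prop :=
  ∃ φ : EE n → Q, φ 0 = q ∧ ContMDiffOn (𝓡 n) (𝓡 n) ∞ φ (Metric.ball 0 ρ) ∧
    Set.InjOn φ (Metric.ball 0 ρ) ∧ Set.MapsTo φ (Metric.ball 0 ρ) S ∧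
    ∀ y ∈ Metric.ball (0 : EE n) ρ, ∀ v w : EE n,
      G.g.inner (φ y) (mfderiv (𝓡 n) (𝓡 n) φ y v) (mfderiv (𝓡 n) (𝓡 n) φ y w) = inner ℝ v w

/-! ### The symplectic manifold `X^A = T*Q / M_Q` -/

/-- The dual lattice `M_Q = N_Q^* ⊂ T*Q`. -/
def M (q : Q) : AddSubgroup (Cot n) where
  carrier := {α | ∀ v ∈ G.N q, ∃ k : ℤ, α v = k}
  zero_mem' := fun _ _ => ⟨0, Int.cast_zero.symm⟩
  add_mem' := by
    intro α β hα hβ v hv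
    obtain ⟨k, hk⟩ := hα v hv
    obtain ⟨l, hl⟩ := hβ v hv
    refine ⟨k + l, ?_⟩
    rw [Int.cast_add, ← hk, ← hl]
    rfl
  neg_mem' := by
    intro α hα v hv
    obtain ⟨k, hk⟩ := hα v hv
    refine ⟨-k, ?_⟩
    rw [Int.cast_neg, ← hk]
    rfl

/-- Two covectors are identified if they lie over the same point and differ by an element
of `M_Q`. -/
def latticeSetoid : Setoid (CotBundle n Q) where
  r x y := ∃ (q : Q) (α β : Cot n), x = ⟨q, α⟩ ∧ y = ⟨q, β⟩ ∧ α - β ∈ G.M q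
  iseqv :=
    { refl := by
        rintro ⟨q, α⟩
        have h : ∀ β : Cot n, β - β ∈ G.M q := fun β => by
          rw [sub_self]; exact (G.M q).zero_mem
        exact ⟨q, α, α, rfl, rfl, h α⟩
      symm := by
        rintro _ _ ⟨q, α, β, rfl, rfl, h⟩
        exact ⟨q, β, α, rfl, rfl, by rw [← neg_sub]; exact (G.M q).neg_mem h⟩
      trans := by
        rintro _ _ _ ⟨q, α, β, rfl, rfl, h⟩ ⟨q', β', γ, h1, rfl, h'⟩
        cases h1
        exact ⟨q, α, γ, rfl, rfl, by rw [← sub_add_sub_cancel α β γ]; exact (G.M q).add_mem h h'⟩ }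

/-- `X^A = T*Q / M_Q`, with the quotient topology. -/
def XA : Type := Quotient G.latticeSetoid

instance : TopologicalSpace G.XA := inferInstanceAs (TopologicalSpace (Quotient G.latticeSetoid))

/-- The quotient map `T*Q → X^A`, which is a covering; the smooth and symplectic structure of `X^A`
is the one for which it is a local symplectomorphism. -/
def toXA (x : CotBundle n Q) : G.XA := Quotient.mk G.latticeSetoid x

/-- The Lagrangian torus fibration `π_A : X^A → Q`. -/
def proj (x : G.XA) : Q :=
  Quotient.lift (fun y : CotBundle n Q => y.proj) (by
    rintro _ _ ⟨q, α, β, rfl, rfl, -⟩; rfl) x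

lemma continuous_proj : Continuous G.proj :=
  Continuous.quotient_lift (FiberBundle.continuous_proj _ _) _

/-- `L ⊂ X^A` is an embedded Lagrangian submanifold (without boundary): locally, its preimage in
`T*Q` is the image of a smooth embedding of an open subset of `ℝⁿ` which pulls `ω` back to zero. -/
def IsLagrangian (L : Set G.XA) : Prop :=
  ∀ x : CotBundle n Q, G.toXA x ∈ L →
    ∃ (U : Set (CotBundle n Q)) (W : Set (EE n)) (φ : EE n → CotBundle n Q),
      IsOpen U ∧ x ∈ U ∧ IsOpen W ∧ φ '' W = U ∩ G.toXA ⁻¹' L ∧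
      IsEmbedding (W.domRestrict φ) ∧ ContMDiffOn (𝓡 n) (CotModel n) ∞ φ W ∧
      ∀ y ∈ W, Function.Injective (mfderiv (𝓡 n) (CotModel n) φ y) ∧
        ∀ v w : EE n, omega n (split n (φ y) (mfderiv (𝓡 n) (CotModel n) φ y v))
          (split n (φ y) (mfderiv (𝓡 n) (CotModel n) φ y w)) = 0

/-- A smooth `ω`-compatible almost complex structure on `X^A`; `J x` acts on the tangent space
`T_q Q ⊕ T*_q Q` at `x`, where `q = π_A(x)`. Smoothness means that, near each point, the entries
of `J` in affine coordinates are smooth functions. -/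
structure CompatibleJ where
  J : G.XA → TX n →L[ℝ] TX n
  sq : ∀ x ξ, J x (J x ξ) = -ξ
  invariant : ∀ x ξ η, omega n (J x ξ) (J x η) = omega n ξ η
  positive : ∀ x ξ, ξ ≠ 0 → 0 < omega n ξ (J x ξ)
  smooth : ∀ x₀ : CotBundle n Q, ContMDiffAt (CotModel n) 𝓘(ℝ, TX n →L[ℝ] TX n) ∞
    (fun x : CotBundle n Q =>
      (toChart n x₀.proj x.proj).comp ((J (G.toXA x)).comp (ofChart n x₀.proj x.proj))) x₀

/-- The isomorphism `T_q Q → T*_q Q` given by the metric. -/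
def flat (q : Q) : EE n ≃L[ℝ] (EE n →L[ℝ] ℝ) :=
  (LinearEquiv.ofBijective ((ContinuousLinearMap.toLinearMap (G.g.inner q)) :
      EE n →ₗ[ℝ] (EE n →L[ℝ] ℝ)) (by
    have hinj : Function.Injective ((ContinuousLinearMap.toLinearMap (G.g.inner q)) :
        EE n →ₗ[ℝ] (EE n →L[ℝ] ℝ)) := by
      refine (injective_iff_map_eq_zero _).2 fun v hv => ?_
      by_contra h
      have h1 := G.g.pos q v h
      have h2 : G.g.inner q v = 0 := hv
      rw [h2] at h1
      exact lt_irrefl _ h1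
    refine ⟨hinj, (LinearMap.injective_iff_surjective_of_finrank_eq_finrank ?_).1 hinj⟩
    rw [← LinearEquiv.finrank_eq (LinearMap.toContinuousLinearMap : (EE n →ₗ[ℝ] ℝ) ≃ₗ[ℝ] _)]
    exact (Subspace.dual_finrank_eq (K := ℝ) (V := EE n)).symm)).toContinuousLinearEquiv

lemma flat_apply (q : Q) (v w : EE n) : G.flat q v w = G.g.inner q v w := rfl

/-- The endomorphism `(v, α) ↦ (-A⁻¹ Φ α, A Φ⁻¹ v)` of `T_q Q ⊕ T*_q Q`, where
`Φ : T*_q Q → T_q Q` is given by the metric; in orthonormal affine coordinates,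
`∂_{q_i} ↦ A ∂_{p_i}` and `∂_{p_i} ↦ -A⁻¹ ∂_{q_i}`. -/
def metricEnd (A : ℝ) (q : Q) : TX n →L[ℝ] TX n :=
  (-A⁻¹ • ((G.flat q).symm : (EE n →L[ℝ] ℝ) →L[ℝ] EE n).comp (ContinuousLinearMap.snd ℝ _ _)).prod
    (A • ((G.flat q) : EE n →L[ℝ] (EE n →L[ℝ] ℝ)).comp (ContinuousLinearMap.fst ℝ _ _))

lemma metricEnd_apply (A : ℝ) (q : Q) (ξ : TX n) :
    G.metricEnd A q ξ = (-A⁻¹ • (G.flat q).symm ξ.2, A • G.flat q ξ.1) := by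
  simp [metricEnd]

lemma flat_comm (q : Q) (v w : EE n) : G.flat q v w = G.flat q w v := G.g.symm q v w

lemma flat_pos (q : Q) (v : EE n) (hv : v ≠ 0) : 0 < G.flat q v v := G.g.pos q v hv

lemma transport_inv (q : Q) : ∀ᶠ q' in 𝓝 q,
    (transport n q q').comp (transportInv n q q') = ContinuousLinearMap.id ℝ (EE n) ∧
    (transportInv n q q').comp (transport n q q') = ContinuousLinearMap.id ℝ (EE n) := by
  have h := (chartAt (EE n) q).open_source.mem_nhds (mem_chart_source (EE n) q)
  filter_upwards [h] with q' hq'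
  have h1 : q' ∈ (extChartAt (𝓡 n) q).source := by rwa [extChartAt_source]
  have h2 : q' ∈ (extChartAt (𝓡 n) q').source := mem_extChartAt_source q'
  constructor
  · ext1 v
    change tangentCoordChange (𝓡 n) q q' q' (tangentCoordChange (𝓡 n) q' q q' v) = v
    rw [tangentCoordChange_comp ⟨⟨h2, h1⟩, h2⟩, tangentCoordChange_self h2]
  · ext1 v
    change tangentCoordChange (𝓡 n) q' q q' (tangentCoordChange (𝓡 n) q q' q' v) = v
    rw [tangentCoordChange_comp ⟨⟨h1, h2⟩, h1⟩, tangentCoordChange_self h1]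

lemma metricEnd_flat (A : ℝ) (q : Q) : ∀ᶠ q' in 𝓝 q,
    (toChart n q q').comp ((G.metricEnd A q').comp (ofChart n q q')) = G.metricEnd A q := by
  filter_upwards [transport_inv (n := n) q, G.g_flat q] with q' ⟨h1, h2⟩ hg
  have h1' : ∀ v, transport n q q' (transportInv n q q' v) = v := fun v =>
    DFunLike.congr_fun h1 v
  have h2' : ∀ v, transportInv n q q' (transport n q q' v) = v := fun v =>
    DFunLike.congr_fun h2 v
  have hfl : ∀ v, (G.flat q' (transport n q q' v)).comp (transport n q q') = G.flat q v := by
    intro v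
    ext w
    exact hg v w
  refine ContinuousLinearMap.ext fun ξ => ?_
  rw [ContinuousLinearMap.comp_apply, ContinuousLinearMap.comp_apply, metricEnd_apply,
    metricEnd_apply]
  have key : transportInv n q q' ((G.flat q').symm (ξ.2.comp (transportInv n q q')))
      = (G.flat q).symm ξ.2 := by
    rw [ContinuousLinearEquiv.eq_symm_apply, ← hfl, h1', ContinuousLinearEquiv.apply_symm_apply,
      ContinuousLinearMap.comp_assoc, h2, ContinuousLinearMap.comp_id]
  refine Prod.ext ?_ ?_
  · change transportInv n q q' (-A⁻¹ • (G.flat q').symm (ξ.2.comp (transportInv n q q'))) = _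
    rw [map_smul, key]
  · change (A • G.flat q' (transport n q q' ξ.1)).comp (transport n q q') = _
    rw [ContinuousLinearMap.smul_comp, hfl]

/-- The rescaled almost complex structure `I_A` determined by the metric. -/
def metricJ (A : ℝ) (hA : 0 < A) : G.CompatibleJ where
  J x := G.metricEnd A (G.proj x)
  sq x ξ := by
    rw [metricEnd_apply, metricEnd_apply]
    ext1
    · simp [smul_smul, inv_mul_cancel₀ hA.ne']
    · simp [smul_smul, mul_inv_cancel₀ hA.ne']
  invariant x ξ η := by
    obtain ⟨v, α⟩ := ξ
    obtain ⟨w, β⟩ := η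
    obtain ⟨a, rfl⟩ := (G.flat (G.proj x)).surjective α
    obtain ⟨b, rfl⟩ := (G.flat (G.proj x)).surjective β
    simp only [metricEnd_apply, omega, ContinuousLinearEquiv.symm_apply_apply, map_smul,
      _root_.smul_apply, smul_eq_mul]
    rw [G.flat_comm _ w a, G.flat_comm _ b v]
    field_simp
    ring
  positive x ξ hξ := by
    obtain ⟨v, α⟩ := ξ
    obtain ⟨a, rfl⟩ := (G.flat (G.proj x)).surjective α
    simp only [metricEnd_apply, omega, ContinuousLinearEquiv.symm_apply_apply, map_smul,
      _root_.smul_apply, smul_eq_mul]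
    have hA' : 0 < A⁻¹ := inv_pos.2 hA
    have nn : ∀ u : EE n, 0 ≤ G.flat (G.proj x) u u := fun u => by
      by_cases hu : u = 0
      · simp [hu]
      · exact (G.flat_pos _ u hu).le
    by_cases hv : v = 0
    · have ha : a ≠ 0 := by
        rintro rfl
        exact hξ (by simp [hv])
      have := mul_pos hA' (G.flat_pos (G.proj x) a ha)
      have := mul_nonneg hA.le (nn v)
      linarith
    · have := mul_pos hA (G.flat_pos (G.proj x) v hv)
      have := mul_nonneg hA'.le (nn a)
      linarith
  smooth x₀ := by
    refine (contMDiffAt_const (c := G.metricEnd A x₀.proj)).congr_of_eventuallyEq ?_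
    exact (FiberBundle.continuous_proj (EE n →L[ℝ] ℝ)
      (fun q : Q => TangentSpace (𝓡 n) q →L[ℝ] Trivial Q ℝ q)).continuousAt.eventually
      (G.metricEnd_flat A x₀.proj)

/-! ### Holomorphic disks -/

/-- `f` is a smooth lift to `T*Q` of `u : D² → X^A` near the point `z` of the closed unit disk. -/
def IsLocalLift (u : ℂ → G.XA) (z : ℂ) (f : ℂ → CotBundle n Q) : Prop :=
  ContMDiffWithinAt 𝓘(ℝ, ℂ) (CotModel n) ∞ f (Metric.closedBall 0 1) z ∧
    ∀ᶠ w in 𝓝[Metric.closedBall 0 1] z, G.toXA (f w) = u w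

/-- `u : D² → X^A` is smooth on the closed unit disk: it has smooth local lifts to `T*Q`. -/
def IsSmoothDisk (u : ℂ → G.XA) : Prop :=
  ∀ z ∈ Metric.closedBall (0 : ℂ) 1, ∃ f, G.IsLocalLift u z f

open Classical in
/-- The differential `du_z : ℂ → T_q Q ⊕ T*_q Q` of a smooth disk, computed with a local lift
(two local lifts differ by a flat section of `M_Q`, hence have the same differential). -/
def diskDeriv (u : ℂ → G.XA) (z : ℂ) (ζ : ℂ) : TX n :=
  if h : ∃ f, G.IsLocalLift u z f then
    split n (h.choose z)
      (mfderivWithin 𝓘(ℝ, ℂ) (CotModel n) h.choose (Metric.closedBall 0 1) z ζ)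
  else 0

/-- `u` is a smooth `J`-holomorphic disk: `du ∘ j = J ∘ du`. -/
def IsHolomorphicDisk (J : G.CompatibleJ) (u : ℂ → G.XA) : Prop :=
  G.IsSmoothDisk u ∧ ∀ z ∈ Metric.closedBall (0 : ℂ) 1, ∀ ζ : ℂ,
    G.diskDeriv u z (Complex.I * ζ) = J.J (u z) (G.diskDeriv u z ζ)

/-- The symplectic area `ω(u) = ∫_{D²} u^*ω`. -/
def area (u : ℂ → G.XA) : ℝ :=
  ∫ z in Metric.closedBall (0 : ℂ) 1, omega n (G.diskDeriv u z 1) (G.diskDeriv u z Complex.I)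

end IntegralMetric

/-! ### First homology and the limit loop grading group -/

/-- First singular homology with integer coefficients. -/
abbrev H1 (X : Type) [TopologicalSpace X] : ModuleCat ℤ :=
  ((AlgebraicTopology.singularHomologyFunctor (ModuleCat ℤ) 1).obj (ModuleCat.of ℤ ℤ)).obj
    (TopCat.of X)

/-- The map `f_* : H₁(X) → H₁(Y)`. -/
def H1map {X Y : Type} [TopologicalSpace X] [TopologicalSpace Y] (f : C(X, Y)) :
    H1 X →ₗ[ℤ] H1 Y :=
  (((AlgebraicTopology.singularHomologyFunctor (ModuleCat ℤ) 1).obj (ModuleCat.of ℤ ℤ)).map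
    (TopCat.ofHom f)).hom

namespace IntegralMetric

variable {n : ℕ} {Q : Type} [TopologicalSpace Q] [ChartedSpace (EE n) Q] [AffineManifold n Q]
  (G : IntegralMetric n Q)

/-- The limit loop grading group `Grd_∞(L, {J_E}) ⊂ H₁(L)`: the subgroup generated by the boundary
classes of the `J_E`-holomorphic disks `u : (D², ∂D²) → (X^A, L)` with `ω(u) ≤ E`, for all `E > 0`.
Here `γ = u|_{∂D²}`, and `c` runs through `H₁(∂D²) = ℤ [∂D²]`, so that the elements `γ_* c` are the
multiples of `[∂u] = γ_* [∂D²]`. -/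
def limitLoopGrading (L : Set G.XA) (J : ℝ → G.CompatibleJ) : Submodule ℤ (H1 L) :=
  Submodule.span ℤ {x | ∃ (E : ℝ) (u : ℂ → G.XA) (γ : C(Circle, L)) (c : H1 Circle),
    0 < E ∧ G.IsHolomorphicDisk (J E) u ∧ G.area u ≤ E ∧
    (∀ z : Circle, (γ z : G.XA) = u z) ∧ x = H1map γ c}

end IntegralMetric

/-! ### Tropical subvarieties and Lagrangian lifts -/

/-- A closed convex polyhedron with nonempty interior in `ℝᵏ`. -/
def IsPolyhedron {k : ℕ} (P : Set (EE k)) : Prop :=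
  (interior P).Nonempty ∧
    ∃ s : Finset ((EE k →L[ℝ] ℝ) × ℝ), P = {y | ∀ h ∈ s, h.1 y ≤ h.2}

section

variable {n : ℕ} {Q : Type} [TopologicalSpace Q] [ChartedSpace (EE n) Q] [AffineManifold n Q]

/-- A closed rational polyhedral cell of `Q`: a closed embedding into `Q` of a polyhedron (possibly
unbounded), affine in the affine charts of `Q`, such that the tangent spaces of the image are
spanned by elements of `N_Q`. -/
structure PolyhedralCell (G : IntegralMetric n Q) where
  dim : ℕ
  P : Set (EE dim)
  isPolyhedron : IsPolyhedron P
  param : EE dim → Q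
  isClosedEmbedding : IsClosedEmbedding (P.domRestrict param)
  affine : ∀ y ∈ P, ∃ a : EE dim →ᵃ[ℝ] EE n, Function.Injective a ∧
    (∀ᶠ y' in 𝓝[P] y, chartAt (EE n) (param y) (param y') = a y') ∧
    Submodule.span ℝ {v : EE n | v ∈ LinearMap.range a.linear ∧ v ∈ G.N (param y)}
      = LinearMap.range a.linear

/-- The underlying closed subset of `Q`. -/
def PolyhedralCell.carrier {G : IntegralMetric n Q} (σ : PolyhedralCell G) : Set Q :=
  σ.param '' σ.P

/-- The subset `S` of `Q` is a (closed, nonempty) face of the cell `σ`. -/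
def PolyhedralCell.IsFace {G : IntegralMetric n Q} (σ : PolyhedralCell G) (S : Set Q) : Prop :=
  ∃ F : Set (EE σ.dim), F.Nonempty ∧ IsExposed ℝ σ.P F ∧ S = σ.param '' F

/-- A tropical subvariety of `Q`: a locally finite regular rational polyhedral complex. (The
balancing condition plays no role and is not imposed.) -/
structure TropicalSubvariety (G : IntegralMetric n Q) where
  Cells : Type
  cell : Cells → PolyhedralCell G
  cell_injective : Function.Injective fun i => (cell i).carrier
  face_mem : ∀ i S, (cell i).IsFace S → ∃ j, (cell j).carrier = S
  inter : ∀ i j, ∀ x ∈ (cell i).carrier ∩ (cell j).carrier,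
    ∃ k, x ∈ (cell k).carrier ∧ (cell i).IsFace (cell k).carrier ∧ (cell j).IsFace (cell k).carrier
  locallyFinite : LocallyFinite fun i => (cell i).carrier

/-- The geometric realization `|V| ⊂ Q`. -/
def TropicalSubvariety.support {G : IntegralMetric n Q} (V : TropicalSubvariety G) : Set Q :=
  ⋃ i, (V.cell i).carrier

/-- `L ⊂ X^A` is a Lagrangian lift of `V` with projection `ε`-close to `V`: an embedded Lagrangian
submanifold with `π_A(L) ⊂ B_ε(|V|)`. (No further condition on the shape of `L` over the cells of
`V` is imposed.) -/
def IsLagrangianLift (G : IntegralMetric n Q) (V : TropicalSubvariety G) (ε : ℝ)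
    (L : Set G.XA) : Prop :=
  G.IsLagrangian L ∧ ∀ x ∈ L, G.proj x ∈ G.thickening V.support ε

/-- The map `π_V : L → B_ε(|V|) ≃ |V|`, where the second map is a homotopy inverse of the
inclusion. -/
def piV {G : IntegralMetric n Q} {V : TropicalSubvariety G} {ε : ℝ} {L : Set G.XA}
    (hL : IsLagrangianLift G V ε L)
    (h : ContinuousMap.HomotopyEquiv V.support (G.thickening V.support ε)) : C(L, V.support) :=
  h.invFun.comp ⟨fun x => ⟨G.proj x, hL.2 x x.2⟩,
    (G.continuous_proj.comp continuous_subtype_val).subtype_mk _⟩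

end

end Trop

end

/-!
An `I_A`-holomorphic disk of area at most `E`, projected to the base, stays within a distance of
order `(E / A) ^ (1/2)` of the projection of its boundary. If `A` is large in comparison with `E`,
the disk therefore projects into `B_ε(|V|)`, and its boundary bounds there.

Let `u` be an `I_A`-holomorphic disk with boundary on `L` and area at most `E`, and let
`q = π_A ∘ u`. Along the disk, which is simply connected, the tangent bundle of the base has a flat
orthonormal frame (`exists_flat_frame`), and in this frame `A q + i p` is a holomorphic coordinate.
Its derivative is a globally defined holomorphic function `F` with `‖F‖² = A e`, where `e` is the
density of the symplectic area (`exists_holomorphic_derivative`), so that `∫ ‖F‖² ≤ A E`. No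
development of the disk into `ℝⁿ` is needed: only `F` is used.

For a holomorphic function with `∫ ‖F‖² ≤ η²` on the unit disk, every interior point is joined to
the unit circle by a segment on which `∫ ‖F‖ ≤ 5 η` (`exists_short_segment`): close to the point the
mean value inequality bounds `F`, and further away one averages in polar coordinates over the
directions pointing roughly outward. As the speed of `q` is at most `‖F‖ / A`, every point of
`q(D²)` lies within `5 (E / A) ^ (1/2)` of `π_A(L)` (`exists_boundary_dist_le`). This replaces a
monotonicity argument, and it needs nothing about the topology of the base.

There is `ρ > 0` such that all points within `ρ` of `π_A(L)` lie in `B_ε(|V|)`: if `L` is compact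
this is a Lebesgue number argument (`exists_uniform_of_isCompact`), and otherwise it holds because
an isometrically embedded flat ball of radius `ρ` contains every point at distance less than `ρ`
from its centre (`HasFlatBall.mem_of_dist_lt`). With `A > 25 E / ρ²`, the whole disk projects into
`B_ε(|V|)`, so `π_V ∘ u|_{∂D²}` factors up to the homotopy inverse through the contractible disk,
and the boundary class dies in `H₁(|V|)` (`H1map_comp_eq_zero`).
-/

noncomputable section

namespace Trop

/-! ### First homology and contractible spaces -/

open CategoryTheory in
theorem H1map_comp {X Y Z : Type} [TopologicalSpace X] [TopologicalSpace Y] [TopologicalSpace Z]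
    (f : C(Y, Z)) (g : C(X, Y)) (c : H1 X) : H1map (f.comp g) c = H1map f (H1map g c) := by
  unfold H1map
  rw [TopCat.ofHom_comp, Functor.map_comp]
  rfl

theorem subsingleton_H1_unit : Subsingleton (H1 PUnit) :=
  ModuleCat.subsingleton_of_isZero
    (AlgebraicTopology.isZero_singularHomologyFunctor_of_totallyDisconnectedSpace
      (ModuleCat ℤ) 1 (ModuleCat.of ℤ ℤ) (TopCat.of PUnit) one_ne_zero)

theorem H1map_eq_of_homotopic {X Y : Type} [TopologicalSpace X] [TopologicalSpace Y]
    {f g : C(X, Y)} (h : f.Homotopic g) : H1map f = H1map g := by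
  obtain ⟨H⟩ := h
  have := TopCat.Homotopy.congr_homologyMap_singularChainComplexFunctor
    (f := TopCat.ofHom f) (g := TopCat.ofHom g) H (ModuleCat.of ℤ ℤ) 1
  exact congrArg ModuleCat.Hom.hom this

/-- A map that factors through a contractible space kills first homology. -/
theorem H1map_comp_eq_zero {X Y Z : Type} [TopologicalSpace X] [TopologicalSpace Y]
    [TopologicalSpace Z] [ContractibleSpace Y] (f : C(Y, Z)) (g : C(X, Y)) (c : H1 X) :
    H1map (f.comp g) c = 0 := by
  obtain ⟨y, hy⟩ := id_nullhomotopic Y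
  have h : g.Homotopic ((ContinuousMap.const PUnit y).comp (ContinuousMap.const X PUnit.unit)) :=
    hy.comp (ContinuousMap.Homotopic.refl g)
  have := subsingleton_H1_unit
  rw [H1map_comp, H1map_eq_of_homotopic h, H1map_comp,
    Subsingleton.elim (H1map (ContinuousMap.const X PUnit.unit) c) 0, map_zero, map_zero]

/-! ### Short segments for holomorphic functions of small energy -/

section ShortSegments

open Set Metric Complex

variable {E : Type*} [NormedAddCommGroup E] [NormedSpace ℂ E]

/-- Polar coordinates centred at `z`, with angles measured from the direction `ν`. -/
theorem lintegral_polar (f : ℂ → ENNReal) (hf : Measurable f) (z ν : ℂ) (hν : ‖ν‖ = 1) :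
    ∫⁻ w, f w = ∫⁻ θ in Ioo (-Real.pi) Real.pi, ∫⁻ r in Ioi (0 : ℝ),
      ENNReal.ofReal r * f (z + r * (exp (θ * I) * ν)) := by
  have h1 : ∫⁻ w, f w = ∫⁻ w, f (z + ν * w) := by
    have hrot := (rotation ⟨ν, mem_sphere_zero_iff_norm.2 hν⟩).measurePreserving
    have h2 := hrot.lintegral_comp (f := fun w => f (z + w))
      (hf.comp (measurable_const.add measurable_id))
    rw [← lintegral_add_left_eq_self f z, ← h2]
    rfl
  rw [h1, ← Complex.lintegral_comp_polarCoord_symm, _root_.polarCoord_target,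
    Measure.volume_eq_prod, setLIntegral_prod_symm]
  · refine lintegral_congr fun θ => lintegral_congr fun r => ?_
    rw [smul_eq_mul, Complex.polarCoord_symm_apply, Complex.ofReal_cos, Complex.ofReal_sin,
      exp_mul_I]
    congr 3
    ring
  · refine Measurable.aemeasurable (Measurable.mul ?_ (hf.comp ?_))
    · exact ENNReal.measurable_ofReal.comp measurable_fst
    · simp only [Complex.polarCoord_symm_apply]
      fun_prop

theorem measurable_indicator_enorm_sq {F : Type*} [NormedAddCommGroup F] {G : ℂ → F}
    {U : Set ℂ} (hU : IsOpen U) (hG : ContinuousOn G U) :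
    Measurable (U.indicator fun w => ‖G w‖ₑ ^ 2) := by
  classical
  rw [← Set.piecewise_eq_indicator]
  exact ContinuousOn.measurable_piecewise ((ENNReal.continuous_pow 2).comp_continuousOn hG.enorm)
    continuousOn_const hU.measurableSet

/-- The mean value inequality for the square of the norm of a holomorphic function on a circle. -/
theorem enorm_sq_le_lintegral_circle [CompleteSpace E] {G : ℂ → E} {z : ℂ} {s : ℝ} (hs : 0 < s)
    (hG : DiffContOnCl ℂ G (ball z s)) :
    ENNReal.ofReal (2 * Real.pi) * ‖G z‖ₑ ^ 2 ≤
      ∫⁻ θ in Ioo (-Real.pi) Real.pi, ‖G (z + s * exp (θ * I))‖ₑ ^ 2 := by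
  have hcont : Continuous fun θ : ℝ => G (circleMap z s θ) := by
    refine hG.continuousOn.comp_continuous (continuous_circleMap z s) fun θ => ?_
    rw [closure_ball z hs.ne']
    exact sphere_subset_closedBall (circleMap_mem_sphere z hs.le θ)
  have hnorm : Continuous fun θ : ℝ => ‖G (circleMap z s θ)‖ := hcont.norm
  have hlin : Continuous fun θ : ℝ => 2 * ‖G z‖ * ‖G (circleMap z s θ)‖ :=
    continuous_const.mul hnorm
  have hmean : (2 * Real.pi) * ‖G z‖ ≤ ∫ θ in (-Real.pi)..Real.pi, ‖G (circleMap z s θ)‖ := by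
    have h1 := DiffContOnCl.circleAverage (f := G) (c := z) (R := s) (by rwa [abs_of_pos hs])
    have hper : Function.Periodic (fun θ => G (circleMap z s θ)) (2 * Real.pi) := fun θ => by
      simp only [periodic_circleMap z s θ]
    have h2 := hper.intervalIntegral_add_eq (-Real.pi) 0
    rw [show -Real.pi + 2 * Real.pi = Real.pi by ring, zero_add] at h2
    have h3 : ‖∫ θ in (-Real.pi)..Real.pi, G (circleMap z s θ)‖ ≤ _ :=
      intervalIntegral.norm_integral_le_integral_norm (by linarith [Real.pi_pos])
    refine le_trans (le_of_eq ?_) h3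
    rw [h2, ← h1, Real.circleAverage_def, norm_smul, Real.norm_eq_abs,
      abs_of_pos (by positivity), ← mul_assoc,
      mul_inv_cancel₀ (by positivity), one_mul]
  have hsq : (2 * Real.pi) * ‖G z‖ ^ 2 ≤
      ∫ θ in (-Real.pi)..Real.pi, ‖G (circleMap z s θ)‖ ^ 2 := by
    -- integrate `2 λ x ≤ λ ^ 2 + x ^ 2` with `λ = ‖G z‖`
    have h1 : ∫ θ in (-Real.pi)..Real.pi, (2 * ‖G z‖ * ‖G (circleMap z s θ)‖ - ‖G z‖ ^ 2) ≤
        ∫ θ in (-Real.pi)..Real.pi, ‖G (circleMap z s θ)‖ ^ 2 := by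
      refine intervalIntegral.integral_mono (by linarith [Real.pi_pos])
        ((hlin.sub continuous_const).intervalIntegrable _ _)
        ((hnorm.pow 2).intervalIntegrable _ _) fun θ => ?_
      simp only
      nlinarith [sq_nonneg (‖G z‖ - ‖G (circleMap z s θ)‖)]
    rw [intervalIntegral.integral_sub (hlin.intervalIntegrable _ _)
      (Continuous.intervalIntegrable (by fun_prop) _ _), intervalIntegral.integral_const_mul,
      intervalIntegral.integral_const, smul_eq_mul] at h1
    have h2 := mul_le_mul_of_nonneg_left hmean (by positivity : 0 ≤ 2 * ‖G z‖)
    nlinarith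
  have hle : (-Real.pi) ≤ Real.pi := by linarith [Real.pi_pos]
  rw [intervalIntegral.integral_of_le hle, ← restrict_Ioo_eq_restrict_Ioc] at hsq
  have h4 := ENNReal.ofReal_le_ofReal hsq
  rw [ofReal_integral_eq_lintegral_ofReal] at h4
  · rw [ENNReal.ofReal_mul (by positivity), ENNReal.ofReal_pow (norm_nonneg _),
      ofReal_norm] at h4
    refine h4.trans (lintegral_mono fun θ => le_of_eq ?_)
    simp only
    rw [ENNReal.ofReal_pow (norm_nonneg _), ofReal_norm]
    rfl
  · exact ((hnorm.pow 2).integrableOn_Icc.mono_set Ioo_subset_Icc_self)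
  · exact Filter.Eventually.of_forall fun θ => by positivity

/-- The area form of the mean value inequality. -/
theorem enorm_sq_le_lintegral_ball [CompleteSpace E] {G : ℂ → E} {z : ℂ} {r : ℝ} (hr : 0 < r)
    (hG : DifferentiableOn ℂ G (ball z r)) :
    ENNReal.ofReal (Real.pi * r ^ 2) * ‖G z‖ₑ ^ 2 ≤ ∫⁻ w in ball z r, ‖G w‖ₑ ^ 2 := by
  have hmeas := measurable_indicator_enorm_sq isOpen_ball hG.continuousOn
  rw [← lintegral_indicator measurableSet_ball, lintegral_polar _ hmeas z 1 norm_one]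
  have hswap : ∫⁻ θ in Ioo (-Real.pi) Real.pi, ∫⁻ s in Ioi (0 : ℝ),
      ENNReal.ofReal s * (ball z r).indicator (fun w => ‖G w‖ₑ ^ 2) (z + s * (exp (θ * I) * 1)) =
      ∫⁻ s in Ioi (0 : ℝ), ∫⁻ θ in Ioo (-Real.pi) Real.pi,
      ENNReal.ofReal s *
        (ball z r).indicator (fun w => ‖G w‖ₑ ^ 2) (z + s * (exp (θ * I) * 1)) := by
    refine lintegral_lintegral_swap (Measurable.aemeasurable ?_)
    refine Measurable.mul (ENNReal.measurable_ofReal.comp measurable_snd) (hmeas.comp ?_)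
    fun_prop
  rw [hswap]
  calc ENNReal.ofReal (Real.pi * r ^ 2) * ‖G z‖ₑ ^ 2
      = ∫⁻ s in Ioo (0 : ℝ) r, ENNReal.ofReal s * (ENNReal.ofReal (2 * Real.pi) * ‖G z‖ₑ ^ 2) := by
        rw [lintegral_mul_const _ ENNReal.measurable_ofReal, ← mul_assoc]
        congr 1
        rw [← ofReal_integral_eq_lintegral_ofReal]
        · rw [← ENNReal.ofReal_mul' (by positivity), restrict_Ioo_eq_restrict_Ioc,
            ← intervalIntegral.integral_of_le hr.le, integral_id]
          congr 1
          ring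
        · exact (continuous_id.integrableOn_Icc (a := 0) (b := r)).mono_set Ioo_subset_Icc_self
        · exact (ae_restrict_iff' measurableSet_Ioo).2 (Filter.Eventually.of_forall
            fun s hs => hs.1.le)
    _ ≤ ∫⁻ s in Ioo (0 : ℝ) r, ∫⁻ θ in Ioo (-Real.pi) Real.pi, ENNReal.ofReal s *
          (ball z r).indicator (fun w => ‖G w‖ₑ ^ 2) (z + s * (exp (θ * I) * 1)) := by
        refine setLIntegral_mono' measurableSet_Ioo fun s hs => ?_
        rw [lintegral_const_mul' _ _ ENNReal.ofReal_ne_top]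
        gcongr
        refine (enorm_sq_le_lintegral_circle hs.1 ?_).trans (le_of_eq ?_)
        · refine (hG.mono ?_).diffContOnCl
          rw [closure_ball z hs.1.ne']
          exact closedBall_subset_ball hs.2
        · refine lintegral_congr fun θ => ?_
          rw [mul_one, indicator_of_mem]
          rw [mem_ball, dist_eq_norm, add_sub_cancel_left, norm_mul, norm_exp_ofReal_mul_I, mul_one,
            Complex.norm_real, Real.norm_eq_abs, abs_of_pos hs.1]
          exact hs.2
    _ ≤ _ := lintegral_mono_set Ioo_subset_Ioi_self

/-- A ray from `z` in the unit disk at an angle less than one radian from the outward normal leaves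
the disk after a length at most `2 (1 - ‖z‖)`. -/
theorem exists_exit_ray {z ν : ℂ} (hz : ‖z‖ < 1) (hν : ‖ν‖ = 1) (hzν : z = ‖z‖ * ν) {θ : ℝ}
    (hθ : θ ∈ Ioo (-1 : ℝ) 1) :
    ∃ R : ℝ, 0 < R ∧ R ≤ 2 * (1 - ‖z‖) ∧ ‖z + R * (exp (θ * I) * ν)‖ = 1 ∧
      ∀ t ∈ Ico 0 R, z + t * (exp (θ * I) * ν) ∈ ball (0 : ℂ) 1 := by
  set w := exp (θ * I) * ν with hw
  have hcos : 1 / 2 ≤ Real.cos θ := by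
    rw [← Real.cos_pi_div_three, ← Real.cos_abs θ]
    refine Real.cos_le_cos_of_nonneg_of_le_pi (abs_nonneg _) (by linarith [Real.pi_pos]) ?_
    have : |θ| < 1 := abs_lt.2 hθ
    linarith [Real.pi_gt_three]
  have hcontinuous : Continuous fun t : ℝ => ‖z + t * w‖ := by fun_prop
  have hend : 1 ≤ ‖z + (2 * (1 - ‖z‖) : ℝ) * w‖ := by
    set a := ‖z‖
    have hre : ‖z + (2 * (1 - a) : ℝ) * w‖ = ‖(a : ℂ) + (2 * (1 - a) : ℝ) * exp (θ * I)‖ := by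
      rw [← mul_one ‖(a : ℂ) + _‖, ← hν, ← norm_mul, hw]
      congr 1
      rw [hzν]
      ring
    rw [hre]
    refine le_trans ?_ (Complex.re_le_norm _)
    simp only [add_re, ofReal_re, mul_re, exp_ofReal_mul_I_re, ofReal_im, zero_mul, sub_zero]
    nlinarith
  obtain ⟨R, hR, hR1⟩ := intermediate_value_Icc (by linarith : (0 : ℝ) ≤ 2 * (1 - ‖z‖))
    hcontinuous.continuousOn ⟨by simpa using hz.le, hend⟩
  have hR1' : ‖z + R * w‖ = 1 := hR1
  have hR0 : 0 < R := by
    rcases hR.1.eq_or_lt with h | h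
    · rw [← h] at hR1'
      simp at hR1'
      exact absurd hR1' hz.ne
    · exact h
  refine ⟨R, hR0, hR.2, hR1', fun t ht => ?_⟩
  -- the point is a convex combination, with positive weight at `z`, of `z` and the exit point
  have hcomb : z + t * w = ((1 - t / R : ℝ) : ℂ) * z + ((t / R : ℝ) : ℂ) * (z + R * w) := by
    push_cast
    have : (R : ℂ) ≠ 0 := by exact_mod_cast hR0.ne'
    field_simp
    ring
  have h1 : t / R < 1 := (div_lt_one hR0).2 ht.2
  have h0 : 0 ≤ t / R := div_nonneg ht.1 hR0.le
  rw [mem_ball_zero_iff, hcomb]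
  refine (norm_add_le _ _).trans_lt ?_
  rw [norm_mul, norm_mul, hR1', Complex.norm_real, Complex.norm_real, Real.norm_eq_abs,
    Real.norm_eq_abs, abs_of_nonneg h0, abs_of_pos (by linarith)]
  nlinarith

/-- Let `G` be holomorphic on the unit disk with `∫ ‖G‖² ≤ η²`. Every point of the disk is joined to
the unit circle by a straight segment on which the integral of `‖G‖` is at most `5 η`. Near the
point, `‖G‖` is controlled by the mean value inequality; away from it, by averaging over the
directions of the segment. -/
theorem exists_short_segment [CompleteSpace E] {G : ℂ → E} {η : ℝ} (hη : 0 < η)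
    (hG : DifferentiableOn ℂ G (ball 0 1))
    (hE : ∫⁻ w in ball (0 : ℂ) 1, ‖G w‖ₑ ^ 2 ≤ ENNReal.ofReal (η ^ 2)) {z : ℂ} (hz : ‖z‖ < 1) :
    ∃ (w : ℂ) (R : ℝ), ‖w‖ = 1 ∧ 0 < R ∧ ‖z + R * w‖ = 1 ∧
      (∀ t ∈ Ico 0 R, z + t * w ∈ ball (0 : ℂ) 1) ∧
      ∫⁻ t in Ioo 0 R, ‖G (z + t * w)‖ₑ ≤ ENNReal.ofReal (5 * η) := by
  obtain ⟨ν, hν, hzν⟩ : ∃ ν : ℂ, ‖ν‖ = 1 ∧ z = ‖z‖ * ν := by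
    by_cases h : z = 0
    · exact ⟨1, norm_one, by simp [h]⟩
    · have h' : (‖z‖ : ℂ) ≠ 0 := by exact_mod_cast norm_ne_zero_iff.2 h
      refine ⟨z / ‖z‖, ?_, by field_simp⟩
      rw [norm_div, Complex.norm_real, norm_norm, div_self (norm_ne_zero_iff.2 h)]
  set f : ℂ → ENNReal := (ball (0 : ℂ) 1).indicator (fun w => ‖G w‖ₑ ^ 2) with hf
  have hmeas : Measurable f := measurable_indicator_enorm_sq isOpen_ball hG.continuousOn
  -- choose a direction with small radial energy
  obtain ⟨θ, hθ, hθE⟩ : ∃ θ ∈ Ioo (-1 : ℝ) 1, ∫⁻ r in Ioi (0 : ℝ),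
      ENNReal.ofReal r * f (z + r * (exp (θ * I) * ν)) ≤ ENNReal.ofReal (η ^ 2 / 2) := by
    have hm : Measurable fun θ : ℝ => ∫⁻ r in Ioi (0 : ℝ),
        ENNReal.ofReal r * f (z + r * (exp (θ * I) * ν)) := by
      refine Measurable.lintegral_prod_right' (f := fun p : ℝ × ℝ =>
        ENNReal.ofReal p.2 * f (z + p.2 * (exp (p.1 * I) * ν))) ?_
      exact (ENNReal.measurable_ofReal.comp measurable_snd).mul (hmeas.comp (by fun_prop))
    have hvol : volume (Ioo (-1 : ℝ) 1) = 2 := by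
      rw [Real.volume_Ioo]; norm_num
    obtain ⟨θ, hθ, h⟩ := exists_le_setLAverage (μ := volume) (s := Ioo (-1 : ℝ) 1)
      (by rw [hvol]; norm_num) (by rw [hvol]; norm_num) hm.aemeasurable
    refine ⟨θ, hθ, h.trans ?_⟩
    rw [setLAverage_eq, hvol, ENNReal.ofReal_div_of_pos two_pos, ENNReal.ofReal_ofNat]
    gcongr
    refine le_trans ?_ hE
    rw [← lintegral_indicator measurableSet_ball, lintegral_polar _ hmeas z ν hν]
    refine lintegral_mono_set (Ioo_subset_Ioo ?_ ?_) <;> linarith [Real.pi_gt_three]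
  obtain ⟨R, hR0, hR, hR1, hin⟩ := exists_exit_ray hz hν hzν hθ
  set w := exp (θ * I) * ν with hw
  have hwn : ‖w‖ = 1 := by rw [hw, norm_mul, norm_exp_ofReal_mul_I, hν, one_mul]
  refine ⟨w, R, hwn, hR0, hR1, hin, ?_⟩
  set d := 1 - ‖z‖ with hd
  have hd0 : 0 < d := sub_pos.2 hz
  have hpt : ∀ t ∈ Ioo 0 R, ‖G (z + t * w)‖ₑ ≤
      ENNReal.ofReal (2 * η / d) + ENNReal.ofReal η⁻¹ * (ENNReal.ofReal t * f (z + t * w)) := by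
    intro t ht
    have hmem := hin t ⟨ht.1.le, ht.2⟩
    by_cases htd : t ≤ d / 2
    · -- the ball of radius `d / 2` around the point lies in the unit disk
      refine le_trans ?_ le_self_add
      have hsub : ball (z + t * w) (d / 2) ⊆ ball (0 : ℂ) 1 := by
        refine ball_subset_ball' ?_
        rw [dist_zero_right]
        have : ‖z + t * w‖ ≤ ‖z‖ + t := by
          refine (norm_add_le _ _).trans ?_
          rw [norm_mul, hwn, mul_one, Complex.norm_real, Real.norm_eq_abs, abs_of_pos ht.1]
        linarith
      have h1 := (enorm_sq_le_lintegral_ball (half_pos hd0) (hG.mono hsub)).trans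
        ((lintegral_mono_set hsub).trans hE)
      rw [← ofReal_norm, ← ENNReal.ofReal_pow (norm_nonneg _),
        ← ENNReal.ofReal_mul (by positivity), ENNReal.ofReal_le_ofReal_iff (by positivity)] at h1
      rw [← ofReal_norm]
      refine ENNReal.ofReal_le_ofReal ?_
      rw [le_div_iff₀ hd0]
      refine le_of_sq_le_sq ?_ (by positivity)
      have h2 : 1 * (d ^ 2 * ‖G (z + t * w)‖ ^ 2) ≤ Real.pi * (d ^ 2 * ‖G (z + t * w)‖ ^ 2) :=
        mul_le_mul_of_nonneg_right (by linarith [Real.pi_gt_three]) (by positivity)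
      nlinarith
    · -- here `t ≥ d / 2`, and `x ≤ c + x ^ 2 / (4 c)` with `c = 2 η / d`
      rw [not_le] at htd
      rw [hf, indicator_of_mem hmem, ← ofReal_norm, ← ENNReal.ofReal_pow (norm_nonneg _),
        ← ENNReal.ofReal_mul ht.1.le, ← ENNReal.ofReal_mul (by positivity),
        ← ENNReal.ofReal_add (by positivity)
          (mul_nonneg (by positivity) (mul_nonneg ht.1.le (by positivity)))]
      refine ENNReal.ofReal_le_ofReal ?_
      set x := ‖G (z + t * w)‖
      have h3 : d / 2 * x ^ 2 ≤ t * x ^ 2 := mul_le_mul_of_nonneg_right htd.le (sq_nonneg x)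
      have h4 : x ≤ 2 * η / d + η⁻¹ * (d / 2 * x ^ 2) := by
        rw [← sub_nonneg]
        have : 2 * η / d + η⁻¹ * (d / 2 * x ^ 2) - x =
            ((2 * η - d * x / 2) ^ 2 + 3 * (d ^ 2 * x ^ 2) / 4) / (2 * η * d) := by
          field_simp
          ring
        rw [this]
        positivity
      have h5 := mul_le_mul_of_nonneg_left h3 (inv_nonneg.2 hη.le)
      linarith
  calc ∫⁻ t in Ioo 0 R, ‖G (z + t * w)‖ₑ
      ≤ ∫⁻ t in Ioo 0 R, (ENNReal.ofReal (2 * η / d) +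
          ENNReal.ofReal η⁻¹ * (ENNReal.ofReal t * f (z + t * w))) :=
        setLIntegral_mono' measurableSet_Ioo hpt
    _ = ENNReal.ofReal (2 * η / d) * ENNReal.ofReal R +
        ENNReal.ofReal η⁻¹ * ∫⁻ t in Ioo 0 R, ENNReal.ofReal t * f (z + t * w) := by
        rw [lintegral_add_left measurable_const, lintegral_const_mul' _ _ ENNReal.ofReal_ne_top,
          setLIntegral_const, Real.volume_Ioo, sub_zero]
    _ ≤ ENNReal.ofReal (2 * η / d) * ENNReal.ofReal (2 * d) +
        ENNReal.ofReal η⁻¹ * ENNReal.ofReal (η ^ 2 / 2) := by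
        gcongr
        exact (lintegral_mono_set Ioo_subset_Ioi_self).trans hθE
    _ ≤ ENNReal.ofReal (5 * η) := by
        rw [← ENNReal.ofReal_mul (by positivity), ← ENNReal.ofReal_mul (by positivity),
          ← ENNReal.ofReal_add (by positivity) (by positivity)]
        refine ENNReal.ofReal_le_ofReal ?_
        have : 2 * η / d * (2 * d) + η⁻¹ * (η ^ 2 / 2) = 4 * η + η / 2 := by
          field_simp
          norm_num
        linarith

end ShortSegments

/-! ### Affine charts and flat transport -/

section AffineCharts

open Set

variable {n : ℕ} {Q : Type} [TopologicalSpace Q] [ChartedSpace (EE n) Q] [AffineManifold n Q]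

/-- Local affineness of a change of preferred charts: it is affine near each point, and its
derivative is locally constant. -/
theorem eventually_chartAt_eq {q₀ q₁ q : Q} (h₀ : q ∈ (chartAt (EE n) q₀).source)
    (h₁ : q ∈ (chartAt (EE n) q₁).source) :
    ∀ᶠ q' in 𝓝 q, chartAt (EE n) q₁ q' = chartAt (EE n) q₁ q +
        tangentCoordChange (𝓡 n) q₀ q₁ q (chartAt (EE n) q₀ q' - chartAt (EE n) q₀ q) ∧
      tangentCoordChange (𝓡 n) q₀ q₁ q' = tangentCoordChange (𝓡 n) q₀ q₁ q := by
  obtain ⟨a, ha⟩ := AffineManifold.affine_transition (n := n) (Q := Q) (chartAt (EE n) q₀)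
    (chart_mem_atlas _ q₀) (chartAt (EE n) q₁) (chart_mem_atlas _ q₁) (chartAt (EE n) q₀ q)
    (by
      rw [OpenPartialHomeomorph.trans_source, OpenPartialHomeomorph.symm_source]
      refine ⟨(chartAt (EE n) q₀).map_source h₀, ?_⟩
      rw [mem_preimage, (chartAt (EE n) q₀).left_inv h₀]
      exact h₁)
  set L : EE n →L[ℝ] EE n := LinearMap.toContinuousLinearMap a.linear with hL
  have hderiv : ∀ q', q' ∈ (chartAt (EE n) q₀).source →
      (∀ᶠ y in 𝓝 (chartAt (EE n) q₀ q'),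
        ((chartAt (EE n) q₀).symm.trans (chartAt (EE n) q₁)) y = a y) →
      tangentCoordChange (𝓡 n) q₀ q₁ q' = L := by
    intro q' _ hy
    rw [tangentCoordChange_def]
    have h2 : range (𝓡 n) = univ := ModelWithCorners.range_eq_univ _
    rw [h2, fderivWithin_univ]
    refine HasFDerivAt.fderiv ?_
    have h3 : HasFDerivAt (fun y => a y) L (chartAt (EE n) q₀ q') := by
      have h4 : (fun y => a y) = fun y => L y + a 0 := by
        funext y
        rw [AffineMap.decomp a]
        simp [hL]
      rw [h4]
      exact L.hasFDerivAt.add_const _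
    exact h3.congr_of_eventuallyEq hy
  have hcont : ContinuousAt (chartAt (EE n) q₀) q := (chartAt (EE n) q₀).continuousAt h₀
  have hq := hderiv q h₀ ha
  have hval : ∀ q', q' ∈ (chartAt (EE n) q₀).source →
      ((chartAt (EE n) q₀).symm.trans (chartAt (EE n) q₁)) (chartAt (EE n) q₀ q')
        = a (chartAt (EE n) q₀ q') → chartAt (EE n) q₁ q' = a (chartAt (EE n) q₀ q') := by
    intro q' hq' h
    rw [← h, OpenPartialHomeomorph.trans_apply, (chartAt (EE n) q₀).left_inv hq']
  filter_upwards [(chartAt (EE n) q₀).open_source.mem_nhds h₀, hcont.eventually ha,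
    hcont.eventually ha.eventually_nhds] with q' hq' h3 h4
  refine ⟨?_, (hderiv q' hq' h4).trans hq.symm⟩
  rw [hval q' hq' h3, hval q h₀ ha.self_of_nhds, hq]
  have := a.linearMap_vsub (chartAt (EE n) q₀ q') (chartAt (EE n) q₀ q)
  rw [vsub_eq_sub, vsub_eq_sub] at this
  change _ = _ + a.linear _
  rw [this]
  abel

theorem transport_comp_transportInv {q q' : Q} (h : q' ∈ (chartAt (EE n) q).source) (v : EE n) :
    transport n q q' (transportInv n q q' v) = v := by
  have h1 : q' ∈ (extChartAt (𝓡 n) q).source := by rwa [extChartAt_source]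
  have h2 : q' ∈ (extChartAt (𝓡 n) q').source := mem_extChartAt_source q'
  change tangentCoordChange (𝓡 n) q q' q' (tangentCoordChange (𝓡 n) q' q q' v) = v
  rw [tangentCoordChange_comp ⟨⟨h2, h1⟩, h2⟩, tangentCoordChange_self h2]

theorem transportInv_comp_transport {q q' : Q} (h : q' ∈ (chartAt (EE n) q).source) (v : EE n) :
    transportInv n q q' (transport n q q' v) = v := by
  have h1 : q' ∈ (extChartAt (𝓡 n) q).source := by rwa [extChartAt_source]
  have h2 : q' ∈ (extChartAt (𝓡 n) q').source := mem_extChartAt_source q'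
  change tangentCoordChange (𝓡 n) q' q q' (tangentCoordChange (𝓡 n) q q' q' v) = v
  rw [tangentCoordChange_comp ⟨⟨h1, h2⟩, h1⟩, tangentCoordChange_self h1]

theorem ofChart_apply (q q' : Q) (ξ : TX n) :
    ofChart n q q' ξ = (transport n q q' ξ.1, ξ.2.comp (transportInv n q q')) := rfl

theorem toChart_ofChart {q q' : Q} (h : q' ∈ (chartAt (EE n) q).source) (ξ : TX n) :
    toChart n q q' (ofChart n q q' ξ) = ξ := by
  refine Prod.ext (transportInv_comp_transport h ξ.1) ?_
  ext v
  change ξ.2 (transportInv n q q' (transport n q q' v)) = _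
  rw [transportInv_comp_transport h]

/-- The flat transport preserves the symplectic form. -/
theorem omega_ofChart {q q' : Q} (h : q' ∈ (chartAt (EE n) q).source) (ξ η : TX n) :
    omega n (ofChart n q q' ξ) (ofChart n q q' η) = omega n ξ η := by
  simp only [omega, ofChart_apply, ContinuousLinearMap.comp_apply, transportInv_comp_transport h]

/-! ### Affine coordinates on the cotangent bundle -/

variable (n) in
/-- The affine coordinates `(q, p)` on `T*Q` induced by the preferred affine chart at `q₀`. -/
def coords (q₀ : Q) (x : CotBundle n Q) : TX n :=
  (chartAt (EE n) q₀ x.proj,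
    ContinuousLinearMap.comp (x.2 : EE n →L[ℝ] ℝ) (transport n q₀ x.proj))

theorem extChartAt_cotBundle (x x' : CotBundle n Q)
    (h : x'.proj ∈ (chartAt (EE n) x.proj).source) :
    extChartAt (CotModel n) x x' = coords n x.proj x' := by
  rw [FiberBundle.extChartAt]
  refine Prod.ext rfl ?_
  change ((trivializationAt (EE n →L[ℝ] ℝ)
    (fun q : Q => TangentSpace (𝓡 n) q →L[ℝ] Trivial Q ℝ q) x.proj) x').2 = _
  rw [hom_trivializationAt_apply, ContinuousLinearMap.inCoordinates]
  change ContinuousLinearMap.comp _ _ = _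
  rw [TangentBundle.symmL_trivializationAt_eq_core h]
  have htriv : (trivializationAt ℝ (Trivial Q ℝ) x.proj).continuousLinearMapAt ℝ x'.proj =
      ContinuousLinearMap.id ℝ ℝ :=
    Bundle.Trivial.continuousLinearMapAt_trivialization ℝ Q ℝ x'.proj
  rw [htriv]
  rfl

/-- The coordinates induced by two affine charts differ by an affine map near each point. -/
theorem eventually_coords_eq {q₀ q₁ : Q} {x : CotBundle n Q}
    (h₀ : x.proj ∈ (chartAt (EE n) q₀).source) (h₁ : x.proj ∈ (chartAt (EE n) q₁).source) :
    ∀ᶠ x' in 𝓝 x, coords n q₁ x' = (chartAt (EE n) q₁ x.proj +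
        tangentCoordChange (𝓡 n) q₀ q₁ x.proj ((coords n q₀ x').1 - chartAt (EE n) q₀ x.proj),
      (coords n q₀ x').2.comp (tangentCoordChange (𝓡 n) q₁ q₀ x.proj)) := by
  have hp : ContinuousAt (fun y : CotBundle n Q => y.proj) x :=
    (FiberBundle.continuous_proj (EE n →L[ℝ] ℝ)
      (fun q : Q => TangentSpace (𝓡 n) q →L[ℝ] Trivial Q ℝ q)).continuousAt
  filter_upwards [hp.eventually (eventually_chartAt_eq h₀ h₁),
    hp.eventually (eventually_chartAt_eq h₁ h₀),
    hp.eventually ((chartAt (EE n) q₀).open_source.mem_nhds h₀),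
    hp.eventually ((chartAt (EE n) q₁).open_source.mem_nhds h₁)] with x' h2 h3 h4 h5
  refine Prod.ext h2.1 ?_
  rw [← h3.2]
  refine ContinuousLinearMap.ext fun v => ?_
  change x'.2 (tangentCoordChange (𝓡 n) q₁ x'.proj x'.proj v) =
    x'.2 (tangentCoordChange (𝓡 n) q₀ x'.proj x'.proj
      (tangentCoordChange (𝓡 n) q₁ q₀ x'.proj v))
  rw [tangentCoordChange_comp]
  simp only [extChartAt_source]
  exact ⟨⟨h5, h4⟩, mem_chart_source _ _⟩

end AffineCharts

/-! ### Maps into the cotangent bundle in affine coordinates -/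

section Coordinates

open Set

variable {n : ℕ} {Q : Type} [TopologicalSpace Q] [ChartedSpace (EE n) Q] [AffineManifold n Q]

theorem continuous_cotBundle_proj : Continuous fun y : CotBundle n Q => y.proj :=
  FiberBundle.continuous_proj (EE n →L[ℝ] ℝ)
    (fun q : Q => TangentSpace (𝓡 n) q →L[ℝ] Trivial Q ℝ q)

theorem eventually_proj_mem {f : ℂ → CotBundle n Q} {s : Set ℂ} {z : ℂ} {q₀ : Q}
    (hf : ContinuousWithinAt f s z) (h₀ : (f z).proj ∈ (chartAt (EE n) q₀).source) :
    ∀ᶠ w in 𝓝[s] z, (f w).proj ∈ (chartAt (EE n) q₀).source :=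
  (continuous_cotBundle_proj.continuousAt.comp_continuousWithinAt hf).eventually
    ((chartAt (EE n) q₀).open_source.mem_nhds h₀)

theorem writtenInExtChartAt_eventuallyEq_coords {f : ℂ → CotBundle n Q} {s : Set ℂ} {z : ℂ}
    (hf : ContinuousWithinAt f s z) :
    writtenInExtChartAt 𝓘(ℝ, ℂ) (CotModel n) z f =ᶠ[𝓝[s] z] fun w => coords n (f z).proj (f w) := by
  filter_upwards [eventually_proj_mem hf (mem_chart_source _ _)] with w hw
  simp only [writtenInExtChartAt, extChartAt_model_space_eq_id, Function.comp_apply,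
    PartialEquiv.refl_symm, PartialEquiv.refl_coe, id_eq]
  exact extChartAt_cotBundle _ _ hw

/-- In the affine coordinates of any chart around `f z`, the differential of a map into `T*Q` is the
ordinary derivative. -/
theorem differentiableWithinAt_coords {f : ℂ → CotBundle n Q} {s : Set ℂ} {z : ℂ} {q₀ : Q}
    (hz : z ∈ s) (hs : UniqueDiffWithinAt ℝ s z)
    (hf : MDifferentiableWithinAt 𝓘(ℝ, ℂ) (CotModel n) f s z)
    (h₀ : (f z).proj ∈ (chartAt (EE n) q₀).source) :
    DifferentiableWithinAt ℝ (fun w => coords n q₀ (f w)) s z ∧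
    ∀ ζ : ℂ, split n (f z) (mfderivWithin 𝓘(ℝ, ℂ) (CotModel n) f s z ζ) =
      ofChart n q₀ (f z).proj (fderivWithin ℝ (fun w => coords n q₀ (f w)) s z ζ) := by
  set q₁ := (f z).proj with hq₁
  have hw := writtenInExtChartAt_eventuallyEq_coords hf.continuousWithinAt
  have hw' := hw.self_of_nhdsWithin hz
  have hd : DifferentiableWithinAt ℝ (fun w => coords n q₁ (f w)) s z := by
    have h1 := hf.differentiableWithinAt_writtenInExtChartAt
    simp only [extChartAt_model_space_eq_id, PartialEquiv.refl_symm, PartialEquiv.refl_coe,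
      preimage_id, inter_univ, id_eq, modelWithCornersSelf_coe, range_id] at h1
    exact h1.congr_of_eventuallyEq hw.symm hw'.symm
  have hmf : mfderivWithin 𝓘(ℝ, ℂ) (CotModel n) f s z =
      fderivWithin ℝ (fun w => coords n q₁ (f w)) s z := by
    rw [hf.mfderivWithin]
    simp only [extChartAt_model_space_eq_id, PartialEquiv.refl_symm, PartialEquiv.refl_coe,
      preimage_id, inter_univ, id_eq, modelWithCornersSelf_coe, range_id]
    exact hw.fderivWithin_eq hw'
  have h01 := hf.continuousWithinAt.eventually
    (eventually_coords_eq (mem_chart_source (EE n) q₁) h₀)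
  have h10 := hf.continuousWithinAt.eventually
    (eventually_coords_eq h₀ (mem_chart_source (EE n) q₁))
  have hd0 : DifferentiableWithinAt ℝ (fun w => coords n q₀ (f w)) s z := by
    refine DifferentiableWithinAt.congr_of_eventuallyEq ?_ h01 (h01.self_of_nhdsWithin hz)
    refine DifferentiableWithinAt.prodMk ?_ ?_
    · exact (((tangentCoordChange (𝓡 n) q₁ q₀ q₁).differentiableAt.comp_differentiableWithinAt z
        (hd.fst.sub_const _)).const_add _)
    · exact hd.snd.clm_comp (differentiableWithinAt_const _)
  refine ⟨hd0, fun ζ => ?_⟩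
  change mfderivWithin 𝓘(ℝ, ℂ) (CotModel n) f s z ζ = _
  rw [hmf]
  have hfd : HasFDerivWithinAt (fun w => coords n q₁ (f w))
      ((ofChart n q₀ q₁).comp (fderivWithin ℝ (fun w => coords n q₀ (f w)) s z)) s z := by
    have h2 := hd0.hasFDerivWithinAt
    have h3 : HasFDerivWithinAt (fun w => ofChart n q₀ q₁ (coords n q₀ (f w)) +
        (chartAt (EE n) q₁ q₁ - tangentCoordChange (𝓡 n) q₀ q₁ q₁ (chartAt (EE n) q₀ q₁), 0))
        ((ofChart n q₀ q₁).comp (fderivWithin ℝ (fun w => coords n q₀ (f w)) s z)) s z :=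
      ((ofChart n q₀ q₁).hasFDerivAt.comp_hasFDerivWithinAt z h2).add_const _
    have h4 : ∀ w, coords n q₁ (f w) = (chartAt (EE n) q₁ (f z).proj +
        tangentCoordChange (𝓡 n) q₀ q₁ (f z).proj
          ((coords n q₀ (f w)).1 - chartAt (EE n) q₀ (f z).proj),
        (coords n q₀ (f w)).2.comp (tangentCoordChange (𝓡 n) q₁ q₀ (f z).proj)) →
        coords n q₁ (f w) = ofChart n q₀ q₁ (coords n q₀ (f w)) +
        (chartAt (EE n) q₁ q₁ - tangentCoordChange (𝓡 n) q₀ q₁ q₁ (chartAt (EE n) q₀ q₁), 0) := by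
      intro w hw
      rw [← hq₁] at hw
      rw [hw, ofChart_apply, map_sub]
      refine Prod.ext ?_ ?_
      · change _ = tangentCoordChange (𝓡 n) q₀ q₁ q₁ _ + (_ - _)
        exact add_sub_left_comm _ _ _
      · exact (add_zero _).symm
    exact h3.congr_of_eventuallyEq (h10.mono h4) (h4 z (h10.self_of_nhdsWithin hz))
  rw [hfd.fderivWithin hs]
  rfl

theorem contDiffWithinAt_coords {f : ℂ → CotBundle n Q} {s : Set ℂ} {z : ℂ}
    (hf : ContMDiffWithinAt 𝓘(ℝ, ℂ) (CotModel n) ∞ f s z) :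
    ContDiffWithinAt ℝ ∞ (fun w => coords n (f z).proj (f w)) s z := by
  have h1 := (contMDiffWithinAt_iff.1 hf).2
  simp only [extChartAt_model_space_eq_id, PartialEquiv.refl_symm, PartialEquiv.refl_coe,
      preimage_id, inter_univ, id_eq, modelWithCornersSelf_coe,
      range_id, Function.comp_id] at h1
  refine h1.congr_of_eventuallyEq ?_ (extChartAt_cotBundle _ _ (mem_chart_source _ _)).symm
  filter_upwards [eventually_proj_mem hf.continuousWithinAt (mem_chart_source _ _)] with w hw
  exact (extChartAt_cotBundle _ _ hw).symm

theorem continuousWithinAt_coords {f : ℂ → CotBundle n Q} {s : Set ℂ} {z : ℂ}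
    (hf : ContinuousWithinAt f s z) :
    ContinuousWithinAt (fun w => coords n (f z).proj (f w)) s z := by
  have h1 : ContinuousWithinAt (fun w => extChartAt (CotModel n) (f z) (f w)) s z :=
    (continuousAt_extChartAt (I := CotModel n) (f z)).comp_continuousWithinAt hf
  refine h1.congr_of_eventuallyEq ?_ (extChartAt_cotBundle _ _ (mem_chart_source _ _)).symm
  filter_upwards [eventually_proj_mem hf (mem_chart_source _ _)] with w hw
  exact (extChartAt_cotBundle _ _ hw).symm

end Coordinates

namespace IntegralMetric

open Set

variable {n : ℕ} {Q : Type} [TopologicalSpace Q] [ChartedSpace (EE n) Q] [AffineManifold n Q]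
  (G : IntegralMetric n Q)

/-- `M_Q` is discrete: a covector of the lattice close to a given one is equal to it. -/
theorem eventually_eq_of_mem_M (q : Q) (α : EE n →L[ℝ] ℝ) (hα : α ∈ G.M q) :
    ∀ᶠ β in 𝓝 α, β ∈ G.M q → β = α := by
  obtain ⟨b, hb⟩ := G.N_basis q
  have h1 : ∀ i, ∀ᶠ β : EE n →L[ℝ] ℝ in 𝓝 α, Dist.dist (β (b i)) (α (b i)) < 1 := fun i =>
    ((ContinuousLinearMap.apply ℝ ℝ (show EE n from b i)).continuous.continuousAt.eventually
      (Metric.ball_mem_nhds _ one_pos))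
  filter_upwards [Filter.eventually_all.2 h1] with β hβ hβM
  have h2 : ∀ i, β (b i) = α (b i) := by
    intro i
    have hbi : b i ∈ G.N q := by rw [hb]; exact AddSubgroup.subset_closure (mem_range_self i)
    obtain ⟨k, hk⟩ := hα _ hbi
    obtain ⟨l, hl⟩ := hβM _ hbi
    have h3 := hβ i
    rw [hk, hl, Real.dist_eq, ← Int.cast_sub, ← Int.cast_abs] at h3
    have h4 : l = k := sub_eq_zero.1 (Int.abs_lt_one_iff.1 (by exact_mod_cast h3))
    rw [hk, hl, h4]
  have h4 : (β : EE n →ₗ[ℝ] ℝ) = (α : EE n →ₗ[ℝ] ℝ) := Module.Basis.ext b h2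
  exact ContinuousLinearMap.coe_injective h4

theorem toXA_eq_iff {x y : CotBundle n Q} : G.toXA x = G.toXA y ↔
    ∃ (q : Q) (α β : Cot n), x = ⟨q, α⟩ ∧ y = ⟨q, β⟩ ∧ α - β ∈ G.M q :=
  Quotient.eq (r := G.latticeSetoid)

/-- Two continuous lifts to `T*Q` of the same map to `X^A` differ by a flat section of `M_Q`. -/
theorem eventually_coords_sub_eq {f f' : ℂ → CotBundle n Q} {s : Set ℂ} {z : ℂ} (hz : z ∈ s)
    (hf : ContinuousWithinAt f s z) (hf' : ContinuousWithinAt f' s z)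
    (h : ∀ᶠ w in 𝓝[s] z, G.toXA (f w) = G.toXA (f' w)) :
    ∃ m : TX n, ∀ᶠ w in 𝓝[s] z,
      coords n (f z).proj (f w) = coords n (f z).proj (f' w) + m := by
  have hproj : ∀ w, G.toXA (f w) = G.toXA (f' w) → (f w).proj = (f' w).proj := fun w hw =>
    congrArg G.proj hw
  have hzp := hproj z (h.self_of_nhdsWithin hz)
  set q₀ := (f z).proj with hq₀
  have hc := continuousWithinAt_coords hf
  have hc' := continuousWithinAt_coords hf'
  rw [← hzp] at hc'
  have hmem : ∀ᶠ w in 𝓝[s] z, (coords n q₀ (f w)).2 - (coords n q₀ (f' w)).2 ∈ G.M q₀ := by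
    have hN := (continuous_cotBundle_proj.continuousAt.comp_continuousWithinAt hf).eventually
      (G.N_flat q₀)
    filter_upwards [h, hN] with w hw hNw v hv
    obtain ⟨q, α, β, hx, hy, hM⟩ := G.toXA_eq_iff.1 hw
    have hv' : transport n q₀ q v ∈ G.N q := by
      have := (hNw v).2 hv
      rw [Function.comp_apply, hx] at this
      exact this
    obtain ⟨k, hk⟩ := hM _ hv'
    refine ⟨k, ?_⟩
    rw [← hk, hx, hy]
    rfl
  have hself := hmem.self_of_nhdsWithin hz
  have hev := (hc.snd.sub hc'.snd).eventually (G.eventually_eq_of_mem_M q₀ _ hself)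
  refine ⟨(0, (coords n q₀ (f z)).2 - (coords n q₀ (f' z)).2), ?_⟩
  filter_upwards [h, hmem, hev] with w hw h1 h2
  refine Prod.ext ?_ ?_
  · change chartAt (EE n) q₀ (f w).proj = chartAt (EE n) q₀ (f' w).proj + 0
    rw [hproj w hw, add_zero]
  · change (coords n q₀ (f w)).2 = (coords n q₀ (f' w)).2 + _
    have h3 : (coords n q₀ (f w)).2 - (coords n q₀ (f' w)).2 =
      (coords n q₀ (f z)).2 - (coords n q₀ (f' z)).2 := h2 h1
    rw [← sub_eq_iff_eq_add', h3]

/-! ### The differential of a smooth disk -/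

section Differential

local notation "𝔻" => Metric.closedBall (0 : ℂ) 1

theorem uniqueDiffWithinAt_disk {z : ℂ} (hz : z ∈ 𝔻) : UniqueDiffWithinAt ℝ 𝔻 z :=
  uniqueDiffWithinAt_convex (convex_closedBall 0 1)
    (by rw [interior_closedBall _ one_ne_zero]; exact ⟨0, by simp⟩)
    (by rwa [Metric.isClosed_closedBall.closure_eq])

/-- The differential of a smooth disk in the affine coordinates of a chart, computed with any
differentiable lift. -/
theorem diskDeriv_eq {u : ℂ → G.XA} (hu : G.IsSmoothDisk u) {z : ℂ} (hz : z ∈ 𝔻)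
    {f : ℂ → CotBundle n Q} (hf : MDifferentiableWithinAt 𝓘(ℝ, ℂ) (CotModel n) f 𝔻 z)
    (hfu : ∀ᶠ w in 𝓝[𝔻] z, G.toXA (f w) = u w) {q₀ : Q}
    (h₀ : (f z).proj ∈ (chartAt (EE n) q₀).source) (ζ : ℂ) :
    G.diskDeriv u z ζ =
      ofChart n q₀ (f z).proj (fderivWithin ℝ (fun w => coords n q₀ (f w)) 𝔻 z ζ) := by
  have hex := hu z hz
  rw [diskDeriv, dif_pos hex]
  set f' := hex.choose with hf'
  have hl : G.IsLocalLift u z f' := hex.choose_spec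
  have hs := uniqueDiffWithinAt_disk hz
  have hd' : MDifferentiableWithinAt 𝓘(ℝ, ℂ) (CotModel n) f' 𝔻 z :=
    hl.1.mdifferentiableWithinAt (by simp)
  obtain ⟨m, hm⟩ := G.eventually_coords_sub_eq hz hf.continuousWithinAt hd'.continuousWithinAt
    (by filter_upwards [hfu, hl.2] with w h1 h2; rw [h1, h2])
  have hzp : (f z).proj = (f' z).proj :=
    congrArg G.proj ((hfu.self_of_nhdsWithin hz).trans (hl.2.self_of_nhdsWithin hz).symm)
  have h1 := (differentiableWithinAt_coords hz hs hf (mem_chart_source _ _)).2 ζ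
  have h2 := (differentiableWithinAt_coords (q₀ := (f z).proj) hz hs hd'
    (by rw [← hzp]; exact mem_chart_source _ _)).2 ζ
  rw [← (differentiableWithinAt_coords hz hs hf h₀).2 ζ, h1, h2, ← hzp]
  congr 2
  have h3 : fderivWithin ℝ (fun w => coords n (f z).proj (f w)) 𝔻 z =
      fderivWithin ℝ (fun w => coords n (f z).proj (f' w) + m) 𝔻 z :=
    Filter.EventuallyEq.fderivWithin_eq hm (hm.self_of_nhdsWithin hz)
  rw [h3, fderivWithin_add_const]

/-- Near each point of the closed disk, a smooth disk is given in the affine coordinates of a chart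
by a smooth function `c`, whose derivative computes the differential of the disk. -/
theorem exists_local_coords {u : ℂ → G.XA} (hu : G.IsSmoothDisk u) {z₀ : ℂ} (hz₀ : z₀ ∈ 𝔻) :
    ∃ c : ℂ → TX n, ContDiffWithinAt ℝ ∞ c 𝔻 z₀ ∧ ∀ᶠ z in 𝓝[𝔻] z₀,
      G.proj (u z) ∈ (chartAt (EE n) (G.proj (u z₀))).source ∧
      (c z).1 = chartAt (EE n) (G.proj (u z₀)) (G.proj (u z)) ∧
      DifferentiableWithinAt ℝ c 𝔻 z ∧
      ∀ ζ, G.diskDeriv u z ζ =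
        ofChart n (G.proj (u z₀)) (G.proj (u z)) (fderivWithin ℝ c 𝔻 z ζ) := by
  obtain ⟨f, hf, hfu⟩ := hu z₀ hz₀
  have hq₀ : (f z₀).proj = G.proj (u z₀) := congrArg G.proj (hfu.self_of_nhdsWithin hz₀)
  have h1 : ∀ᶠ z in 𝓝[𝔻] z₀, MDifferentiableWithinAt 𝓘(ℝ, ℂ) (CotModel n) f 𝔻 z := by
    have h2 := (contMDiffWithinAt_iff_contMDiffWithinAt_nhdsWithin (n := 1) (by simp)).1
      (ContMDiffWithinAt.of_le hf (by simp))
    rw [insert_eq_of_mem hz₀] at h2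
    exact h2.mono fun z h3 => h3.mdifferentiableWithinAt one_ne_zero
  refine ⟨fun w => coords n (f z₀).proj (f w), contDiffWithinAt_coords hf, ?_⟩
  rw [← hq₀]
  filter_upwards [h1, eventually_eventually_nhdsWithin.2 hfu, self_mem_nhdsWithin,
    eventually_proj_mem hf.continuousWithinAt (mem_chart_source _ _)] with z h2 h3 h4 h5
  have hq : (f z).proj = G.proj (u z) := congrArg G.proj (h3.self_of_nhdsWithin h4)
  rw [← hq]
  exact ⟨h5, rfl, (differentiableWithinAt_coords h4 (uniqueDiffWithinAt_disk h4) h2 h5).1,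
    G.diskDeriv_eq hu h4 h2 h3 h5⟩

end Differential

end IntegralMetric

/-! ### Flat frames along a disk -/

section FlatFrames

open Set

variable (n : ℕ) (Q : Type) [TopologicalSpace Q] [ChartedSpace (EE n) Q] [AffineManifold n Q]

/-- An `n`-tuple of vectors of `ℝⁿ`, where the set of such tuples carries the discrete topology. -/
def Frame : Type := Fin n → EE n

instance : TopologicalSpace (Frame n) := ⊥

instance : DiscreteTopology (Frame n) := ⟨rfl⟩

/-- The bundle of `n`-tuples of tangent vectors of `Q` with discrete fibres. The transition maps are
those of the tangent bundle; they are locally constant as `Q` is affine, and the topology is the one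
for which the flat tuples are the continuous ones. -/
def flatFrameCore : FiberBundleCore Q Q (Frame n) where
  baseSet q₀ := (chartAt (EE n) q₀).source
  isOpen_baseSet q₀ := (chartAt (EE n) q₀).open_source
  indexAt q₀ := q₀
  mem_baseSet_at := mem_chart_source (EE n)
  coordChange q₀ q₁ q v := fun k => tangentCoordChange (𝓡 n) q₀ q₁ q (v k)
  coordChange_self _ q hq _ :=
    funext fun _ => tangentCoordChange_self (by rwa [extChartAt_source])
  continuousOn_coordChange q₀ q₁ := by
    rintro ⟨q, v⟩ ⟨⟨hi, hj⟩, -⟩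
    refine ContinuousAt.continuousWithinAt ?_
    have hv : ∀ᶠ v' in 𝓝 v, v' = v := by rw [nhds_discrete (Frame n)]; rfl
    let c : Frame n := fun k => tangentCoordChange (𝓡 n) q₀ q₁ q (v k)
    have hc : ContinuousAt (fun _ : Q × Frame n => c) (q, v) := continuousAt_const
    refine hc.congr ?_
    filter_upwards [(eventually_chartAt_eq hi hj).prod_nhds hv] with p hp
    rw [hp.1.2, hp.2]
  coordChange_comp q₀ q₁ q₂ q hq v := funext fun k => tangentCoordChange_comp (by
    simpa only [extChartAt_source] using hq)

variable {n Q}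

/-- Along a continuous map from the open unit disk, every tuple of vectors extends to a flat one. -/
theorem exists_flat_frame (q : ℂ → Q) (hq : ContinuousOn q (Metric.ball 0 1)) (T₀ : Fin n → EE n) :
    ∃ T : ℂ → Fin n → EE n, T 0 = T₀ ∧ ∀ z ∈ Metric.ball (0 : ℂ) 1,
      ∀ᶠ w in 𝓝 z, ∀ i, T w i = transport n (q z) (q w) (T z i) := by
  have hcov : IsCoveringMap (flatFrameCore n Q).proj := FiberBundle.isCoveringMap
  have : SimplyConnectedSpace (Metric.ball (0 : ℂ) 1) := by
    have := (convex_ball (0 : ℂ) 1).contractibleSpace ⟨0, by simp⟩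
    infer_instance
  have : LocallyPathConnectedSpace (Metric.ball (0 : ℂ) 1) :=
    Metric.isOpen_ball.locallyPathConnectedSpace
  obtain ⟨s, ⟨hs0, hs⟩, -⟩ := hcov.existsUnique_continuousMap_lifts
    ⟨fun z : Metric.ball (0 : ℂ) 1 => q z, continuousOn_iff_continuous_domRestrict.1 hq⟩
    ⟨0, by simp⟩ ⟨q 0, T₀⟩ rfl
  have hsq : ∀ z, (s z).1 = q z := fun z => congrFun hs z
  classical
  let T : ℂ → Fin n → EE n := fun z =>
    if hz : z ∈ Metric.ball (0 : ℂ) 1 then (s ⟨z, hz⟩).2 else T₀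
  have hT : ∀ z (hz : z ∈ Metric.ball (0 : ℂ) 1), T z = (s ⟨z, hz⟩).2 := fun z hz => dif_pos hz
  refine ⟨T, ?_, fun z hz => ?_⟩
  · rw [hT 0 (by simp), hs0]
  · set e := (flatFrameCore n Q).localTrivAt (q z) with he
    have hcont : ContinuousAt (fun w => (e (s w)).2) ⟨z, hz⟩ := by
      refine ContinuousAt.snd (ContinuousAt.comp (g := e) ?_ s.continuous.continuousAt)
      refine e.continuousAt ?_
      rw [he, FiberBundleCore.mem_localTrivAt_source]
      change (s ⟨z, hz⟩).1 ∈ (chartAt (EE n) (q z)).source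
      rw [hsq]
      exact mem_chart_source _ _
    have hev : ∀ᶠ w : Metric.ball (0 : ℂ) 1 in 𝓝 ⟨z, hz⟩,
        (e (s w)).2 = (e (s ⟨z, hz⟩)).2 := by
      have := hcont.tendsto
      rw [nhds_discrete (Frame n), Filter.tendsto_pure] at this
      exact this
    have hev2 : ∀ᶠ w : Metric.ball (0 : ℂ) 1 in 𝓝 ⟨z, hz⟩,
        q w ∈ (chartAt (EE n) (q z)).source :=
      (continuousOn_iff_continuous_domRestrict.1 hq).continuousAt.eventually
        ((chartAt (EE n) (q z)).open_source.mem_nhds (mem_chart_source _ _))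
    have h3 := eventually_nhds_subtype_iff _ ⟨z, hz⟩ (fun w : ℂ =>
      ∀ i, T w i = transport n (q z) (q w) (T z i)) |>.1 (by
        filter_upwards [hev, hev2] with w h1 h2 i
        have h4 := congrFun h1 i
        rw [he, FiberBundleCore.localTrivAt_snd, FiberBundleCore.localTrivAt_snd] at h4
        change tangentCoordChange (𝓡 n) (s w).1 (q z) (s w).1 ((s w).2 i) =
          tangentCoordChange (𝓡 n) (s ⟨z, hz⟩).1 (q z) (s ⟨z, hz⟩).1 ((s ⟨z, hz⟩).2 i) at h4
        rw [hsq, hsq, ← hT z hz, ← hT w w.2,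
          tangentCoordChange_self (mem_extChartAt_source (q z))] at h4
        rw [← h4]
        change _ = transport n (q z) (q w) (transportInv n (q z) (q w) (T w i))
        exact (transport_comp_transportInv h2 _).symm)
    rwa [Metric.isOpen_ball.nhdsWithin_eq hz] at h3

end FlatFrames

/-! ### Orthonormal frames, and the energy density of a disk -/

namespace IntegralMetric

section Energy

open Set

variable {n : ℕ} {Q : Type} [TopologicalSpace Q] [ChartedSpace (EE n) Q] [AffineManifold n Q]
  (G : IntegralMetric n Q)

local notation "𝔻" => Metric.closedBall (0 : ℂ) 1

/-- The vectors `T i` are orthonormal for the metric at `q`. -/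
def IsOrthonormalFrame (q : Q) (T : Fin n → EE n) : Prop :=
  ∀ i j, G.flat q (T i) (T j) = if i = j then 1 else 0

theorem exists_isOrthonormalFrame (q : Q) : ∃ T : Fin n → EE n, G.IsOrthonormalFrame q T := by
  let _ : RiemannianBundle (fun q : Q => TangentSpace (𝓡 n) q) := ⟨G.g.toRiemannianMetric⟩
  have : FiniteDimensional ℝ (TangentSpace (𝓡 n) q) :=
    inferInstanceAs (FiniteDimensional ℝ (EE n))
  have hn : Module.finrank ℝ (TangentSpace (𝓡 n) q) = n := finrank_euclideanSpace_fin (𝕜 := ℝ)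
  let b := (stdOrthonormalBasis ℝ (TangentSpace (𝓡 n) q)).reindex (finCongr hn)
  exact ⟨fun i => b i, fun i j => orthonormal_iff_ite.1 b.orthonormal i j⟩

theorem IsOrthonormalFrame.sum_sq {q : Q} {T : Fin n → EE n} (hT : G.IsOrthonormalFrame q T)
    (v : EE n) : ∑ i, G.flat q v (T i) ^ 2 = G.flat q v v := by
  let _ : RiemannianBundle (fun q : Q => TangentSpace (𝓡 n) q) := ⟨G.g.toRiemannianMetric⟩
  have : FiniteDimensional ℝ (TangentSpace (𝓡 n) q) :=
    inferInstanceAs (FiniteDimensional ℝ (EE n))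
  have hn : Module.finrank ℝ (TangentSpace (𝓡 n) q) = n := finrank_euclideanSpace_fin (𝕜 := ℝ)
  let T' : Fin n → TangentSpace (𝓡 n) q := T
  have ho : Orthonormal ℝ T' := orthonormal_iff_ite.2 hT
  rcases isEmpty_or_nonempty (Fin n) with hE | hE
  · have h0 : v = 0 := by
      have := hE
      exact Subsingleton.elim _ _
    rw [h0, Finset.sum_of_isEmpty, map_zero]
  let B := basisOfOrthonormalOfCardEqFinrank ho ((Fintype.card_fin n).trans hn.symm)
  have hB : ⇑B = T' := coe_basisOfOrthonormalOfCardEqFinrank ho _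
  let b := B.toOrthonormalBasis (by rw [hB]; exact ho)
  have hb : ∀ i, b i = T' i := fun i => by
    rw [Module.Basis.coe_toOrthonormalBasis, hB]
  let v' : TangentSpace (𝓡 n) q := v
  have h1 := b.sum_sq_inner_left v'
  simp only [hb] at h1
  refine h1.trans ?_
  rw [← real_inner_self_eq_norm_sq]
  rfl

theorem metricEnd_fst (A : ℝ) (q : Q) (ξ : TX n) :
    (G.metricEnd A q ξ).1 = -A⁻¹ • (G.flat q).symm ξ.2 := by rw [metricEnd_apply]

theorem metricEnd_snd (A : ℝ) (q : Q) (ξ : TX n) :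
    (G.metricEnd A q ξ).2 = A • G.flat q ξ.1 := by rw [metricEnd_apply]

theorem omega_metricEnd (A : ℝ) (q : Q) (ξ : TX n) : omega n ξ (G.metricEnd A q ξ) =
    A * G.flat q ξ.1 ξ.1 + A⁻¹ * ξ.2 ((G.flat q).symm ξ.2) := by
  rw [omega, metricEnd_fst, metricEnd_snd, map_smul, smul_eq_mul, _root_.smul_apply, smul_eq_mul]
  ring

theorem flat_self_nonneg (q : Q) (v : EE n) : 0 ≤ G.flat q v v := by
  by_cases h : v = 0
  · simp [h]
  · exact (G.flat_pos q v h).le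

theorem apply_flat_symm_nonneg (q : Q) (α : EE n →L[ℝ] ℝ) : 0 ≤ α ((G.flat q).symm α) := by
  obtain ⟨a, rfl⟩ := (G.flat q).surjective α
  rw [ContinuousLinearEquiv.symm_apply_apply]
  exact G.flat_self_nonneg q a

/-- The density of the symplectic area of a disk. -/
def energyDensity (u : ℂ → G.XA) (z : ℂ) : ℝ :=
  omega n (G.diskDeriv u z 1) (G.diskDeriv u z Complex.I)

variable {G}

theorem diskDeriv_eq_re_im {u : ℂ → G.XA} (hu : G.IsSmoothDisk u) {z : ℂ} (hz : z ∈ 𝔻) (ζ : ℂ) :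
    G.diskDeriv u z ζ = ζ.re • G.diskDeriv u z 1 + ζ.im • G.diskDeriv u z Complex.I := by
  obtain ⟨c, -, hc⟩ := G.exists_local_coords hu hz
  obtain ⟨-, -, -, h⟩ := hc.self_of_nhdsWithin hz
  rw [h, h, h, ← map_smul, ← map_smul, ← map_smul, ← map_smul, ← map_add, ← map_add]
  congr 2
  conv_lhs => rw [← Complex.re_add_im ζ]
  simp

/-- The energy density controls the speed of the projection to the base. -/
theorem flat_diskDeriv_le {A : ℝ} {hA : 0 < A} {u : ℂ → G.XA}
    (hu : G.IsHolomorphicDisk (G.metricJ A hA) u) {z : ℂ} (hz : z ∈ 𝔻) (ζ : ℂ) :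
    A * G.flat (G.proj (u z)) (G.diskDeriv u z ζ).1 (G.diskDeriv u z ζ).1 ≤
      ‖ζ‖ ^ 2 * G.energyDensity u z := by
  have h1 : omega n (G.diskDeriv u z ζ) (G.diskDeriv u z (Complex.I * ζ)) =
      ‖ζ‖ ^ 2 * G.energyDensity u z := by
    rw [diskDeriv_eq_re_im hu.1 hz ζ, diskDeriv_eq_re_im hu.1 hz (Complex.I * ζ),
      energyDensity, ← Complex.normSq_eq_norm_sq, Complex.normSq_apply]
    simp only [omega, Complex.mul_re, Complex.mul_im, Complex.I_re, Complex.I_im, Prod.fst_add,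
      Prod.snd_add, Prod.smul_fst, Prod.smul_snd, map_add, map_smul, _root_.add_apply,
      _root_.smul_apply, smul_eq_mul]
    ring
  have h2 : G.diskDeriv u z (Complex.I * ζ) =
      G.metricEnd A (G.proj (u z)) (G.diskDeriv u z ζ) := hu.2 z hz ζ
  rw [← h1, h2, omega_metricEnd]
  have := mul_nonneg (inv_nonneg.2 hA.le)
    (G.apply_flat_symm_nonneg (G.proj (u z)) (G.diskDeriv u z ζ).2)
  linarith

theorem energyDensity_nonneg {A : ℝ} {hA : 0 < A} {u : ℂ → G.XA}
    (hu : G.IsHolomorphicDisk (G.metricJ A hA) u) {z : ℂ} (hz : z ∈ 𝔻) :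
    0 ≤ G.energyDensity u z := by
  have h := flat_diskDeriv_le hu hz 1
  rw [norm_one, one_pow, one_mul] at h
  exact (mul_nonneg hA.le (G.flat_self_nonneg _ _)).trans h

theorem continuousOn_energyDensity {u : ℂ → G.XA} (hu : G.IsSmoothDisk u) :
    ContinuousOn (G.energyDensity u) 𝔻 := by
  intro z hz
  obtain ⟨c, hc, hev⟩ := G.exists_local_coords hu hz
  have hd : ContinuousWithinAt (fderivWithin ℝ c 𝔻) 𝔻 z :=
    (hc.fderivWithin_right (m := 0) (fun w hw => uniqueDiffWithinAt_disk hw) (by simp)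
      hz).continuousWithinAt
  have h1 : ∀ ζ : ℂ, ContinuousWithinAt (fun w => fderivWithin ℝ c 𝔻 w ζ) 𝔻 z := fun ζ =>
    hd.clm_apply continuousWithinAt_const
  have h2 : ContinuousWithinAt (fun w => omega n (fderivWithin ℝ c 𝔻 w 1)
      (fderivWithin ℝ c 𝔻 w Complex.I)) 𝔻 z := by
    unfold omega
    exact ((h1 Complex.I).snd.clm_apply (h1 1).fst).sub ((h1 1).snd.clm_apply (h1 Complex.I).fst)
  have h3 : ∀ᶠ w in 𝓝[𝔻] z, G.energyDensity u w = omega n (fderivWithin ℝ c 𝔻 w 1)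
      (fderivWithin ℝ c 𝔻 w Complex.I) := by
    filter_upwards [hev] with w hw'
    obtain ⟨hw, -, -, h⟩ := hw'
    rw [energyDensity, h, h, omega_ofChart hw]
  exact h2.congr_of_eventuallyEq h3 (h3.self_of_nhdsWithin hz)

/-- The projection to the base of a smooth disk is smooth, and its differential is the horizontal
component of the differential of the disk. -/
theorem contMDiffWithinAt_proj {u : ℂ → G.XA} (hu : G.IsSmoothDisk u) {z : ℂ} (hz : z ∈ 𝔻) :
    ContMDiffWithinAt 𝓘(ℝ, ℂ) (𝓡 n) ∞ (fun w => G.proj (u w)) 𝔻 z ∧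
    ∀ ζ, mfderivWithin 𝓘(ℝ, ℂ) (𝓡 n) (fun w => G.proj (u w)) 𝔻 z ζ = (G.diskDeriv u z ζ).1 := by
  obtain ⟨c, hc, hev⟩ := G.exists_local_coords hu hz
  set q₀ := G.proj (u z) with hq₀
  have hself := hev.self_of_nhdsWithin hz
  have hcont : ContinuousWithinAt (fun w => G.proj (u w)) 𝔻 z := by
    have h1 : ContinuousWithinAt (fun w => (chartAt (EE n) q₀).symm (c w).1) 𝔻 z := by
      refine ContinuousAt.comp_continuousWithinAt (g := (chartAt (EE n) q₀).symm) ?_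
        hc.continuousWithinAt.fst
      rw [hself.2.1]
      exact (chartAt (EE n) q₀).continuousAt_symm ((chartAt (EE n) q₀).map_source hself.1)
    have h2 : ∀ᶠ w in 𝓝[𝔻] z, G.proj (u w) = (chartAt (EE n) q₀).symm (c w).1 := by
      filter_upwards [hev] with w hw
      rw [hw.2.1, (chartAt (EE n) q₀).left_inv hw.1]
    exact h1.congr_of_eventuallyEq h2 (h2.self_of_nhdsWithin hz)
  have hw : writtenInExtChartAt 𝓘(ℝ, ℂ) (𝓡 n) z (fun w => G.proj (u w)) =ᶠ[𝓝[𝔻] z]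
      fun w => (c w).1 := by
    filter_upwards [hev] with w hw
    simp only [writtenInExtChartAt, extChartAt_model_space_eq_id, Function.comp_apply,
      PartialEquiv.refl_symm, PartialEquiv.refl_coe, id_eq]
    exact hw.2.1.symm
  have hsm : ContMDiffWithinAt 𝓘(ℝ, ℂ) (𝓡 n) ∞ (fun w => G.proj (u w)) 𝔻 z := by
    rw [contMDiffWithinAt_iff]
    refine ⟨hcont, ?_⟩
    simp only [extChartAt_model_space_eq_id, PartialEquiv.refl_symm, PartialEquiv.refl_coe,
      preimage_id, inter_univ, id_eq, modelWithCornersSelf_coe, range_id, Function.comp_id]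
    refine (hc.fst).congr_of_eventuallyEq ?_ ?_
    · filter_upwards [hev] with w hw
      exact hw.2.1.symm
    · exact hself.2.1.symm
  refine ⟨hsm, fun ζ => ?_⟩
  have hmd := hsm.mdifferentiableWithinAt (by simp)
  have hm : mfderivWithin 𝓘(ℝ, ℂ) (𝓡 n) (fun w => G.proj (u w)) 𝔻 z =
      fderivWithin ℝ (fun w => (c w).1) 𝔻 z := by
    rw [hmd.mfderivWithin]
    simp only [extChartAt_model_space_eq_id, PartialEquiv.refl_symm, PartialEquiv.refl_coe,
      preimage_id, inter_univ, id_eq, modelWithCornersSelf_coe, range_id]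
    exact hw.fderivWithin_eq (hw.self_of_nhdsWithin hz)
  rw [hm, fderivWithin.fst (uniqueDiffWithinAt_disk hz) hself.2.2.1]
  exact ((congrArg Prod.fst (hself.2.2.2 ζ)).trans
    (tangentCoordChange_self (mem_extChartAt_source q₀))).symm

/-- Holomorphy of a disk in the affine coordinates of a chart. -/
theorem fderivWithin_I_mul {A : ℝ} {hA : 0 < A} {u : ℂ → G.XA}
    (hu : G.IsHolomorphicDisk (G.metricJ A hA) u) {z : ℂ} (hz : z ∈ 𝔻) {q₀ : Q}
    {D : ℂ →L[ℝ] TX n} (hq : G.proj (u z) ∈ (chartAt (EE n) q₀).source)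
    (hflat : (toChart n q₀ (G.proj (u z))).comp
      ((G.metricEnd A (G.proj (u z))).comp (ofChart n q₀ (G.proj (u z)))) = G.metricEnd A q₀)
    (hD : ∀ ζ, G.diskDeriv u z ζ = ofChart n q₀ (G.proj (u z)) (D ζ)) (ζ : ℂ) :
    D (Complex.I * ζ) = G.metricEnd A q₀ (D ζ) := by
  have h1 : G.diskDeriv u z (Complex.I * ζ) =
      G.metricEnd A (G.proj (u z)) (G.diskDeriv u z ζ) := hu.2 z hz ζ
  rw [hD, hD] at h1
  rw [← toChart_ofChart hq (D (Complex.I * ζ)), h1, ← hflat]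
  rfl

/-- The complex coordinate `A q + i p` in the direction of a vector `t`, for which `I_A` becomes the
multiplication by `i`. -/
def complexCoord (G : IntegralMetric n Q) (A : ℝ) (q : Q) (t : EE n) : TX n →L[ℝ] ℂ :=
  (A • Complex.ofRealCLM.comp ((G.flat q t).comp (ContinuousLinearMap.fst ℝ _ _))) +
    Complex.I • Complex.ofRealCLM.comp
      ((ContinuousLinearMap.apply ℝ ℝ t).comp (ContinuousLinearMap.snd ℝ _ _))

theorem complexCoord_apply (A : ℝ) (q : Q) (t : EE n) (ξ : TX n) :
    complexCoord G A q t ξ = ((A * G.flat q ξ.1 t : ℝ) : ℂ) + Complex.I * ((ξ.2 t : ℝ) : ℂ) := by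
  rw [G.flat_comm q ξ.1 t]
  simp [complexCoord]

theorem complexCoord_metricEnd {A : ℝ} (hA : 0 < A) (q : Q) (t : EE n) (ξ : TX n) :
    complexCoord G A q t (G.metricEnd A q ξ) = Complex.I * complexCoord G A q t ξ := by
  have h1 : G.flat q ((G.flat q).symm ξ.2) t = ξ.2 t := by
    rw [ContinuousLinearEquiv.apply_symm_apply]
  rw [complexCoord_apply, complexCoord_apply, metricEnd_fst, metricEnd_snd, map_smul,
    _root_.smul_apply, h1, _root_.smul_apply, smul_eq_mul, smul_eq_mul, neg_mul, mul_neg,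
    mul_inv_cancel_left₀ hA.ne', mul_add, ← mul_assoc, Complex.I_mul_I]
  push_cast
  ring

theorem eventually_isOrthonormalFrame {q₀ : Q} (T : Fin n → EE n) :
    ∀ᶠ q in 𝓝 q₀, G.IsOrthonormalFrame q (fun i => transport n q₀ q (T i)) ↔
      G.IsOrthonormalFrame q₀ T := by
  filter_upwards [G.g_flat q₀] with q hq
  exact forall₂_congr fun i j => by
    rw [flat_apply, hq]
    rfl

/-- A flat frame along the disk which is orthonormal at the centre is orthonormal everywhere. -/
theorem isOrthonormalFrame_of_flat {q : ℂ → Q} (hq : ContinuousOn q (Metric.ball 0 1))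
    {T : ℂ → Fin n → EE n} (h0 : G.IsOrthonormalFrame (q 0) (T 0))
    (hT : ∀ z ∈ Metric.ball (0 : ℂ) 1,
      ∀ᶠ w in 𝓝 z, ∀ i, T w i = transport n (q z) (q w) (T z i)) :
    ∀ z ∈ Metric.ball (0 : ℂ) 1, G.IsOrthonormalFrame (q z) (T z) := by
  have hpre : IsPreconnected (Metric.ball (0 : ℂ) 1) := (convex_ball 0 1).isPreconnected
  have hloc : ∀ z ∈ Metric.ball (0 : ℂ) 1, ∀ᶠ w in 𝓝 z,
      (G.IsOrthonormalFrame (q w) (T w) ↔ G.IsOrthonormalFrame (q z) (T z)) := by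
    intro z hz
    have hqz : ContinuousAt q z := hq.continuousAt (Metric.isOpen_ball.mem_nhds hz)
    filter_upwards [hT z hz, hqz.eventually (G.eventually_isOrthonormalFrame (T z))] with w h1 h2
    rw [← h2]
    exact iff_of_eq (congrArg _ (funext h1))
  intro z hz
  refine hpre.induction₂ (fun x y => G.IsOrthonormalFrame (q x) (T x) ↔
    G.IsOrthonormalFrame (q y) (T y)) (fun x hx => ?_) (fun x y w _ _ _ h1 h2 => h1.trans h2)
    (fun x y _ _ h => h.symm) (Metric.mem_ball_self one_pos) hz |>.1 h0
  exact (hloc x hx).filter_mono nhdsWithin_le_nhds |>.mono fun w h => h.symm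

/-- For an `I_A`-holomorphic disk, the derivative of `A q + i p` in a flat orthonormal frame is a
holomorphic function on the open disk, and its square norm is `A` times the energy density. -/
theorem exists_holomorphic_derivative {A : ℝ} {hA : 0 < A} {u : ℂ → G.XA}
    (hu : G.IsHolomorphicDisk (G.metricJ A hA) u) :
    ∃ F : ℂ → EuclideanSpace ℂ (Fin n), DifferentiableOn ℂ F (Metric.ball 0 1) ∧
      ∀ z ∈ Metric.ball (0 : ℂ) 1, ‖F z‖ ^ 2 = A * G.energyDensity u z := by
  set q : ℂ → Q := fun z => G.proj (u z) with hqdef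
  have hsub : Metric.ball (0 : ℂ) 1 ⊆ 𝔻 := Metric.ball_subset_closedBall
  have hq : ContinuousOn q (Metric.ball 0 1) := fun z hz =>
    (contMDiffWithinAt_proj hu.1 (hsub hz)).1.continuousWithinAt.mono hsub
  obtain ⟨T₀, hT₀⟩ := G.exists_isOrthonormalFrame (q 0)
  obtain ⟨T, hT0, hT⟩ := exists_flat_frame q hq T₀
  have hort := isOrthonormalFrame_of_flat hq (by rwa [hT0]) hT
  refine ⟨fun z => WithLp.toLp 2 fun i => complexCoord G A (q z) (T z i) (G.diskDeriv u z 1),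
    ?_, fun z hz => ?_⟩
  · rw [differentiableOn_euclidean]
    intro i z₀ hz₀
    refine DifferentiableAt.differentiableWithinAt ?_
    have hnhds : 𝓝[𝔻] z₀ = 𝓝 z₀ :=
      nhdsWithin_eq_nhds.2 (Filter.mem_of_superset (Metric.isOpen_ball.mem_nhds hz₀) hsub)
    obtain ⟨c, hc, hev⟩ := G.exists_local_coords hu.1 (hsub hz₀)
    rw [hnhds] at hev
    have hqz : ContinuousAt q z₀ := hq.continuousAt (Metric.isOpen_ball.mem_nhds hz₀)
    set ℓ := complexCoord G A (q z₀) (T z₀ i)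
    -- in affine coordinates around the point, the function is the derivative of `ℓ ∘ c`
    have hkey : ∀ᶠ z in 𝓝 z₀, DifferentiableAt ℂ (fun w => ℓ (c w)) z ∧
        complexCoord G A (q z) (T z i) (G.diskDeriv u z 1) = deriv (fun w => ℓ (c w)) z := by
      filter_upwards [hev, Metric.isOpen_ball.mem_nhds hz₀, hT z₀ hz₀,
        hqz.eventually (G.metricEnd_flat A (q z₀)), hqz.eventually (G.g_flat (q z₀))] with
        z h1 hz h2 h3 h4
      obtain ⟨hsrc, -, hcd, hD⟩ := h1
      have hzn : 𝔻 ∈ 𝓝 z := Filter.mem_of_superset (Metric.isOpen_ball.mem_nhds hz) hsub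
      rw [fderivWithin_of_mem_nhds hzn] at hD
      have hcd' : HasFDerivAt c (fderiv ℝ c z) z := (hcd.differentiableAt hzn).hasFDerivAt
      have hℓ : HasFDerivAt (fun w => ℓ (c w)) (ℓ.comp (fderiv ℝ c z)) z :=
        ℓ.hasFDerivAt.comp z hcd'
      have hI := fderivWithin_I_mul hu (hsub hz) hsrc h3 hD 1
      have hdiff : DifferentiableAt ℂ (fun w => ℓ (c w)) z := by
        rw [differentiableAt_complex_iff_differentiableAt_real]
        refine ⟨hℓ.differentiableAt, ?_⟩
        rw [hℓ.fderiv, ContinuousLinearMap.comp_apply, ContinuousLinearMap.comp_apply,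
          ← mul_one Complex.I, hI, complexCoord_metricEnd hA, mul_one, smul_eq_mul]
      refine ⟨hdiff, ?_⟩
      have h5 : deriv (fun w => ℓ (c w)) z = ℓ (fderiv ℝ c z 1) := by
        have h6 := (hdiff.hasDerivAt.hasFDerivAt.restrictScalars ℝ).unique hℓ
        have h7 := congrArg (fun L => L 1) h6
        simpa using h7
      rw [h5, hD, h2 i, complexCoord_apply, complexCoord_apply, ofChart_apply]
      congr 1
      · congr 2
        rw [flat_apply]
        exact h4 _ _
      · congr 2
        rw [ContinuousLinearMap.comp_apply, transportInv_comp_transport hsrc]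
    have han : AnalyticAt ℂ (fun w => ℓ (c w)) z₀ :=
      Complex.analyticAt_iff_eventually_differentiableAt.2 (hkey.mono fun z h => h.1)
    exact han.deriv.differentiableAt.congr_of_eventuallyEq (hkey.mono fun z h => h.2)
  · rw [EuclideanSpace.norm_sq_eq]
    have h1 : G.diskDeriv u z Complex.I = G.metricEnd A (q z) (G.diskDeriv u z 1) := by
      have := hu.2 z (hsub hz) 1
      rwa [mul_one] at this
    rw [energyDensity, h1, omega_metricEnd]
    set ξ := G.diskDeriv u z 1
    obtain ⟨a, ha⟩ := (G.flat (q z)).surjective ξ.2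
    have h2 : ∀ i, ‖complexCoord G A (q z) (T z i) ξ‖ ^ 2 =
        A ^ 2 * G.flat (q z) ξ.1 (T z i) ^ 2 + G.flat (q z) a (T z i) ^ 2 := fun i => by
      rw [complexCoord_apply, ← Complex.normSq_eq_norm_sq, mul_comm Complex.I,
        Complex.normSq_add_mul_I, ← ha]
      ring
    rw [Finset.sum_congr rfl fun i _ => h2 i, Finset.sum_add_distrib, ← Finset.mul_sum,
      (hort z hz).sum_sq, (hort z hz).sum_sq, ← ha, ContinuousLinearEquiv.symm_apply_apply]
    field_simp

end Energy

end IntegralMetric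

/-! ### The Riemannian distance of the base -/

namespace IntegralMetric

section Distance

open Set Function

variable {n : ℕ} {Q : Type} [TopologicalSpace Q] [ChartedSpace (EE n) Q] [AffineManifold n Q]
  (G : IntegralMetric n Q)

instance : IsManifold (𝓡 n) 1 Q := IsManifold.of_le (n := ∞) (by simp)

theorem dist_comm (x y : Q) : G.dist x y = G.dist y x := by
  let _ : RiemannianBundle (fun q : Q => TangentSpace (𝓡 n) q) := ⟨G.g.toRiemannianMetric⟩
  exact Manifold.riemannianEDist_comm

theorem dist_triangle (x y z : Q) : G.dist x z ≤ G.dist x y + G.dist y z := by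
  let _ : RiemannianBundle (fun q : Q => TangentSpace (𝓡 n) q) := ⟨G.g.toRiemannianMetric⟩
  exact Manifold.riemannianEDist_triangle

theorem eventually_dist_lt (x : Q) {r : ENNReal} (hr : 0 < r) : ∀ᶠ y in 𝓝 x, G.dist x y < r := by
  let _ : RiemannianBundle (fun q : Q => TangentSpace (𝓡 n) q) := ⟨G.g.toRiemannianMetric⟩
  have : IsContinuousRiemannianBundle (EE n) (fun q : Q => TangentSpace (𝓡 n) q) :=
    ⟨G.g.inner, G.g.contMDiff.continuous, fun _ _ _ => rfl⟩
  exact _root_.eventually_riemannianEDist_lt (𝓡 n) x hr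

theorem dist_le_lintegral {γ : ℝ → Q} {R : ℝ} (hR : 0 ≤ R)
    (hγ : ContMDiffOn 𝓘(ℝ, ℝ) (𝓡 n) 1 γ (Icc 0 R)) :
    G.dist (γ 0) (γ R) ≤ ∫⁻ t in Icc 0 R, ENNReal.ofReal √(G.flat (γ t)
      (mfderivWithin 𝓘(ℝ, ℝ) (𝓡 n) γ (Icc 0 R) t (1 : ℝ))
      (mfderivWithin 𝓘(ℝ, ℝ) (𝓡 n) γ (Icc 0 R) t (1 : ℝ))) := by
  let _ : RiemannianBundle (fun q : Q => TangentSpace (𝓡 n) q) := ⟨G.g.toRiemannianMetric⟩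
  have h := Manifold.riemannianEDist_le_pathELength (I := 𝓡 n) hγ rfl rfl hR
  rw [Manifold.pathELength_eq_lintegral_mfderivWithin_Icc] at h
  refine h.trans (le_of_eq (lintegral_congr fun t => ?_))
  rw [← ofReal_norm, norm_eq_sqrt_real_inner]
  rfl

theorem exists_path_of_dist_lt {x y : Q} {r : ENNReal} (h : G.dist x y < r) :
    ∃ γ : ℝ → Q, γ 0 = x ∧ γ 1 = y ∧ ContMDiff 𝓘(ℝ, ℝ) (𝓡 n) 1 γ ∧
      ∫⁻ t in Icc 0 1, ENNReal.ofReal √(G.flat (γ t) (mfderiv 𝓘(ℝ, ℝ) (𝓡 n) γ t (1 : ℝ))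
        (mfderiv 𝓘(ℝ, ℝ) (𝓡 n) γ t (1 : ℝ))) < r := by
  let _ : RiemannianBundle (fun q : Q => TangentSpace (𝓡 n) q) := ⟨G.g.toRiemannianMetric⟩
  obtain ⟨γ, h0, h1, hγ, hl, -, -⟩ :=
    Manifold.exists_lt_locally_constant_of_riemannianEDist_lt h zero_lt_one
  refine ⟨γ, h0, h1, hγ, lt_of_le_of_lt (le_of_eq (lintegral_congr fun t => ?_))
    (Manifold.pathELength_eq_lintegral_mfderiv_Icc (I := 𝓡 n) (γ := γ) ▸ hl)⟩
  rw [← ofReal_norm, norm_eq_sqrt_real_inner]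
  rfl

/-- A compact subset of a neighbourhood `B_ε(S)` has a uniform neighbourhood inside `B_ε(S)`. -/
theorem exists_uniform_of_isCompact {K S : Set Q} {ε : ℝ} (hK : IsCompact K)
    (hKS : K ⊆ G.thickening S ε) :
    ∃ ρ : ℝ, 0 < ρ ∧ ∀ y ∈ K, ∀ q, G.dist y q < ENNReal.ofReal ρ → q ∈ G.thickening S ε := by
  refine hK.induction_on (p := fun K => ∃ ρ : ℝ, 0 < ρ ∧ ∀ y ∈ K, ∀ q,
    G.dist y q < ENNReal.ofReal ρ → q ∈ G.thickening S ε) ⟨1, one_pos, by simp⟩ ?_ ?_ ?_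
  · rintro s t hst ⟨ρ, h0, h⟩
    exact ⟨ρ, h0, fun y hy => h y (hst hy)⟩
  · rintro s t ⟨ρ, h0, h⟩ ⟨ρ', h0', h'⟩
    refine ⟨min ρ ρ', lt_min h0 h0', ?_⟩
    rintro y (hy | hy) q hq
    · exact h y hy q (hq.trans_le (ENNReal.ofReal_le_ofReal (min_le_left _ _)))
    · exact h' y hy q (hq.trans_le (ENNReal.ofReal_le_ofReal (min_le_right _ _)))
  · intro y hy
    obtain ⟨v, hv, hvy⟩ := hKS hy
    obtain ⟨a, ha0, ha, haε⟩ := (ENNReal.lt_iff_exists_real_btwn).1 hvy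
    have hε : 0 < ε := ENNReal.ofReal_pos.1 (lt_of_le_of_lt zero_le hvy)
    have haε' : a < ε := (ENNReal.ofReal_lt_ofReal_iff hε).1 haε
    have hr : 0 < (ε - a) / 2 := by linarith
    refine ⟨{y' | G.dist y y' < ENNReal.ofReal ((ε - a) / 2)},
      nhdsWithin_le_nhds (G.eventually_dist_lt y (ENNReal.ofReal_pos.2 hr)), _, hr, ?_⟩
    intro y' hy' q hq
    refine ⟨v, hv, ?_⟩
    calc G.dist v q ≤ G.dist v y + (G.dist y y' + G.dist y' q) :=
          (G.dist_triangle v y q).trans (add_le_add_right (G.dist_triangle y y' q) _)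
      _ < ENNReal.ofReal a + (ENNReal.ofReal ((ε - a) / 2) + ENNReal.ofReal ((ε - a) / 2)) :=
          ENNReal.add_lt_add ha (ENNReal.add_lt_add hy' hq)
      _ = ENNReal.ofReal ε := by
          rw [← ENNReal.ofReal_add hr.le hr.le, ← ENNReal.ofReal_add ha0 (by linarith)]
          congr 1
          ring

/-- The inverse of an isometric embedding of a flat ball is smooth on the (open) image, by the
inverse function theorem. -/
theorem exists_smooth_inverse {φ : EE n → Q} {ρ : ℝ}
    (hφ : ContMDiffOn (𝓡 n) (𝓡 n) ∞ φ (Metric.ball 0 ρ)) (hinj : InjOn φ (Metric.ball 0 ρ))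
    (hiso : ∀ y ∈ Metric.ball (0 : EE n) ρ, ∀ v w : EE n,
      G.g.inner (φ y) (mfderiv (𝓡 n) (𝓡 n) φ y v) (mfderiv (𝓡 n) (𝓡 n) φ y w) = inner ℝ v w)
    {y : EE n} (hy : y ∈ Metric.ball 0 ρ) :
    φ '' Metric.ball 0 ρ ∈ 𝓝 (φ y) ∧
      ContMDiffAt (𝓡 n) (𝓡 n) 1 (invFunOn φ (Metric.ball 0 ρ)) (φ y) := by
  have hyn := Metric.isOpen_ball.mem_nhds hy
  have hφy : ContMDiffAt (𝓡 n) (𝓡 n) 1 φ y := (hφ.contMDiffAt hyn).of_le (by simp)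
  -- `Φ` is the map `φ` in the chart at `φ y`
  set Φ : EE n → EE n := fun p => chartAt (EE n) (φ y) (φ p) with hΦ
  have hΦd : ContDiffAt ℝ 1 Φ y := by
    have h1 := (contMDiffAt_iff.1 hφy).2
    simp only [extChartAt_model_space_eq_id, PartialEquiv.refl_symm, PartialEquiv.refl_coe,
      id_eq, modelWithCornersSelf_coe, range_id, Function.comp_id, contDiffWithinAt_univ] at h1
    exact h1
  have hm : mfderiv (𝓡 n) (𝓡 n) φ y = fderiv ℝ Φ y := by
    rw [(hφy.mdifferentiableAt one_ne_zero).mfderiv]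
    simp only [extChartAt_model_space_eq_id, PartialEquiv.refl_coe,
      id_eq, modelWithCornersSelf_coe, range_id, fderivWithin_univ]
    rfl
  have hker : Injective (fderiv ℝ Φ y) := by
    refine (injective_iff_map_eq_zero _).2 fun v hv => ?_
    have h1 := hiso y hy v v
    rw [hm] at h1
    have h2 : G.g.inner (φ y) (fderiv ℝ Φ y v) (fderiv ℝ Φ y v) = 0 := by
      rw [hv]
      exact congrArg (fun L => L 0) (map_zero (G.g.inner (φ y)))
    exact inner_self_eq_zero.1 (h1.symm.trans h2)
  set L : EE n ≃L[ℝ] EE n :=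
    (LinearEquiv.ofInjectiveEndo (fderiv ℝ Φ y : EE n →ₗ[ℝ] EE n) hker).toContinuousLinearEquiv
  have hL : HasFDerivAt Φ (L : EE n →L[ℝ] EE n) y :=
    (hΦd.differentiableAt one_ne_zero).hasFDerivAt
  set e := hΦd.toOpenPartialHomeomorph Φ hL one_ne_zero
  have hey : e.symm (Φ y) = y := e.left_inv (hΦd.mem_toOpenPartialHomeomorph_source hL one_ne_zero)
  have het : Φ y ∈ e.target := hΦd.image_mem_toOpenPartialHomeomorph_target hL one_ne_zero
  have hsm : ContDiffAt ℝ 1 e.symm (Φ y) := hΦd.to_localInverse hL one_ne_zero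
  have hchart : ContinuousAt (chartAt (EE n) (φ y)) (φ y) :=
    (chartAt (EE n) (φ y)).continuousAt (mem_chart_source _ _)
  have hp : ContinuousAt (fun q => e.symm (chartAt (EE n) (φ y) q)) (φ y) :=
    ContinuousAt.comp (g := e.symm) hsm.continuousAt hchart
  have hp' : Filter.Tendsto (fun q => e.symm (chartAt (EE n) (φ y) q)) (𝓝 (φ y)) (𝓝 y) := by
    have h := hp.tendsto
    rwa [show e.symm (chartAt (EE n) (φ y) (φ y)) = y from hey] at h
  have hev : ∀ᶠ q in 𝓝 (φ y), q ∈ φ '' Metric.ball 0 ρ ∧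
      invFunOn φ (Metric.ball 0 ρ) q = e.symm (chartAt (EE n) (φ y) q) := by
    filter_upwards [hp'.eventually hyn,
      hp'.eventually (hφy.continuousAt.eventually ((chartAt (EE n) (φ y)).open_source.mem_nhds
        (mem_chart_source _ _))),
      (chartAt (EE n) (φ y)).open_source.mem_nhds (mem_chart_source _ _),
      hchart.eventually (e.open_target.mem_nhds het)] with q h1 h2 h3 h4
    have h5 : φ (e.symm (chartAt (EE n) (φ y) q)) = q :=
      (chartAt (EE n) (φ y)).injOn h2 h3 (e.right_inv h4)
    refine ⟨⟨_, h1, h5⟩, ?_⟩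
    conv_lhs => rw [← h5]
    exact hinj.leftInvOn_invFunOn h1
  refine ⟨hev.mono fun q h => h.1, ?_⟩
  have h6 : ContMDiffAt (𝓡 n) (𝓡 n) 1 (fun q => e.symm (chartAt (EE n) (φ y) q)) (φ y) :=
    ContMDiffAt.comp (g := e.symm) (φ y) hsm.contMDiffAt
      (contMDiffAt_extChartAt (I := 𝓡 n) (n := 1))
  exact h6.congr_of_eventuallyEq (hev.mono fun q h => h.2)

/-- A flat ball of radius `ρ` contains every point at distance less than `ρ` from its centre: a path
shorter than `ρ` from the centre has a lift to the flat ball of the same length, which cannot reach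
the boundary. -/
theorem HasFlatBall.mem_of_dist_lt [T2Space Q] {q₀ q : Q} {ρ : ℝ} {S : Set Q}
    (h : G.HasFlatBall q₀ ρ S) (hq : G.dist q₀ q < ENNReal.ofReal ρ) : q ∈ S := by
  obtain ⟨φ, hφ0, hφ, hinj, hmaps, hiso⟩ := h
  obtain ⟨γ, hγ0, hγ1, hγ, hlen⟩ := G.exists_path_of_dist_lt hq
  -- leave some room between the length of `γ` and `ρ`, so as to work in a compact ball
  obtain ⟨ρ', hρ'0, hlen', hρ'⟩ := ENNReal.lt_iff_exists_real_btwn.1 hlen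
  have hρ0 : 0 < ρ := ENNReal.ofReal_pos.1 (lt_of_le_of_lt zero_le hlen)
  have hρ : ρ' < ρ := (ENNReal.ofReal_lt_ofReal_iff hρ0).1 hρ'
  set B := Metric.ball (0 : EE n) ρ with hB
  set Ψ := invFunOn φ B
  have hΨφ : ∀ y ∈ B, Ψ (φ y) = y := fun y hy => hinj.leftInvOn_invFunOn hy
  have hinv : ∀ y ∈ B, φ '' B ∈ 𝓝 (φ y) ∧ ContMDiffAt (𝓡 n) (𝓡 n) 1 Ψ (φ y) := fun y hy =>
    G.exists_smooth_inverse hφ hinj hiso hy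
  -- the inverse is an isometry
  have hnorm : ∀ y ∈ B, ∀ v w : EE n, w = mfderiv (𝓡 n) (𝓡 n) Ψ (φ y) v →
      ‖w‖ = √(G.flat (φ y) v v) := by
    rintro y hy v w rfl
    have hφd : MDifferentiableAt (𝓡 n) (𝓡 n) φ y :=
      (hφ.contMDiffAt (Metric.isOpen_ball.mem_nhds hy)).mdifferentiableAt (by simp)
    have hΨd : MDifferentiableAt (𝓡 n) (𝓡 n) Ψ (φ y) :=
      (hinv y hy).2.mdifferentiableAt one_ne_zero
    have h1 : ∀ᶠ x in 𝓝 (φ y), φ (Ψ x) = x := by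
      filter_upwards [(hinv y hy).1] with x hx
      obtain ⟨p, hp, rfl⟩ := hx
      rw [hΨφ p hp]
    have h2 : mfderiv (𝓡 n) (𝓡 n) (φ ∘ Ψ) (φ y) = ContinuousLinearMap.id ℝ (EE n) :=
      (Filter.EventuallyEq.mfderiv_eq (f₁ := φ ∘ Ψ) (f := id) h1).trans mfderiv_id
    rw [mfderiv_comp (φ y) (by rw [hΨφ y hy]; exact hφd) hΨd, hΨφ y hy] at h2
    have h3 : mfderiv (𝓡 n) (𝓡 n) φ y (mfderiv (𝓡 n) (𝓡 n) Ψ (φ y) v) = v :=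
      DFunLike.congr_fun h2 v
    have h4 := hiso y hy (mfderiv (𝓡 n) (𝓡 n) Ψ (φ y) v) (mfderiv (𝓡 n) (𝓡 n) Ψ (φ y) v)
    rw [h3] at h4
    exact (norm_eq_sqrt_real_inner (F := EE n) _).trans (congrArg Real.sqrt h4.symm)
  set K := φ '' Metric.closedBall 0 ρ' with hK
  have hsub : Metric.closedBall (0 : EE n) ρ' ⊆ B := Metric.closedBall_subset_ball hρ
  have hKclosed : IsClosed K :=
    ((isCompact_closedBall 0 ρ').image_of_continuousOn (hφ.continuousOn.mono hsub)).isClosed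
  have hclosed : IsClosed (γ ⁻¹' K ∩ Icc 0 1) :=
    (hKclosed.preimage hγ.continuous).inter isClosed_Icc
  have hzero : (0 : ℝ) ∈ γ ⁻¹' K := ⟨0, by simpa using hρ'0, by rw [hφ0, hγ0]⟩
  -- the set of times up to which `γ` stays in the compact ball `K` is closed, and it is open as the
  -- lift of `γ` stays at distance less than `ρ'` from the centre
  have hmem : Icc (0 : ℝ) 1 ⊆ γ ⁻¹' K := by
    refine hclosed.Icc_subset_of_forall_mem_nhdsGT_of_Icc_subset hzero ?_
    rintro t₁ ⟨ht0, ht1⟩ ht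
    have hin : ∀ t ∈ Icc 0 t₁, ∃ y ∈ B, φ y = γ t := fun t h =>
      let ⟨y, hy, h'⟩ := ht h
      ⟨y, hsub hy, h'⟩
    have hC : ContMDiffOn 𝓘(ℝ, ℝ) (𝓡 n) 1 (Ψ ∘ γ) (Icc 0 t₁) := by
      intro t h
      obtain ⟨y, hy, h'⟩ := hin t h
      refine ContMDiffAt.comp_contMDiffWithinAt t ?_ (hγ.contMDiffAt.contMDiffWithinAt)
      rw [← h']
      exact (hinv y hy).2
    have hdist : ‖(Ψ ∘ γ) t₁ - (Ψ ∘ γ) 0‖ₑ < ENNReal.ofReal ρ' := by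
      rcases ht0.eq_or_lt with rfl | hpos
      · rw [sub_self, enorm_zero]
        exact lt_of_le_of_lt zero_le hlen'
      calc ‖(Ψ ∘ γ) t₁ - (Ψ ∘ γ) 0‖ₑ
          ≤ ∫⁻ t in Icc 0 t₁, ‖derivWithin (Ψ ∘ γ) (Icc 0 t₁) t‖ₑ :=
            enorm_sub_le_lintegral_derivWithin_Icc_of_contDiffOn_Icc
              (contMDiffOn_iff_contDiffOn.1 hC) ht0
        _ = ∫⁻ t in Icc 0 t₁, ENNReal.ofReal √(G.flat (γ t)
              (mfderiv 𝓘(ℝ, ℝ) (𝓡 n) γ t (1 : ℝ)) (mfderiv 𝓘(ℝ, ℝ) (𝓡 n) γ t (1 : ℝ))) := by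
            refine setLIntegral_congr_fun measurableSet_Icc fun t h => ?_
            obtain ⟨y, hy, h'⟩ := hin t h
            have hγd : MDifferentiableAt 𝓘(ℝ, ℝ) (𝓡 n) γ t :=
              hγ.mdifferentiable one_ne_zero t
            have hΨd : MDifferentiableAt (𝓡 n) (𝓡 n) Ψ (γ t) := by
              rw [← h']
              exact (hinv y hy).2.mdifferentiableAt one_ne_zero
            let D : ℝ →L[ℝ] EE n :=
              (mfderiv (𝓡 n) (𝓡 n) Ψ (γ t)).comp (mfderiv 𝓘(ℝ, ℝ) (𝓡 n) γ t)
            have h1 : HasFDerivAt (Ψ ∘ γ) D t :=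
              (hΨd.hasMFDerivAt.comp t hγd.hasMFDerivAt).hasFDerivAt
            have h2 : HasFDerivWithinAt (Ψ ∘ γ) D (Icc 0 t₁) t := h1.hasFDerivWithinAt
            have h3 : derivWithin (Ψ ∘ γ) (Icc 0 t₁) t =
                mfderiv (𝓡 n) (𝓡 n) Ψ (γ t) (mfderiv 𝓘(ℝ, ℝ) (𝓡 n) γ t (1 : ℝ)) :=
              h2.hasDerivWithinAt.derivWithin (uniqueDiffOn_Icc hpos t h)
            beta_reduce
            rw [h3, ← h']
            refine (ofReal_norm (E := EE n) _).symm.trans ?_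
            exact congrArg _ (hnorm y hy _ _ rfl)
        _ ≤ ∫⁻ t in Icc 0 1, ENNReal.ofReal √(G.flat (γ t)
              (mfderiv 𝓘(ℝ, ℝ) (𝓡 n) γ t (1 : ℝ)) (mfderiv 𝓘(ℝ, ℝ) (𝓡 n) γ t (1 : ℝ))) :=
            lintegral_mono_set (Icc_subset_Icc le_rfl ht1.le)
        _ < ENNReal.ofReal ρ' := hlen'
    obtain ⟨y, hy, hyt⟩ := hin t₁ ⟨ht0, le_rfl⟩
    have hnhds : ∀ᶠ x in 𝓝 (γ t₁), x ∈ K := by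
      have h1 : Ψ (γ t₁) ∈ Metric.ball (0 : EE n) ρ' := by
        have h0 : Ψ (γ 0) = 0 := by
          rw [hγ0, ← hφ0]
          exact hΨφ 0 (Metric.mem_ball_self hρ0)
        rw [Function.comp_apply, Function.comp_apply, h0, sub_zero, ← ofReal_norm] at hdist
        rw [mem_ball_zero_iff]
        exact lt_of_not_ge fun hge => (ENNReal.ofReal_le_ofReal hge).not_gt hdist
      rw [← hyt] at h1 ⊢
      filter_upwards [(hinv y hy).1,
        (hinv y hy).2.continuousAt.eventually (Metric.isOpen_ball.mem_nhds h1)] with x hx hx'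
      obtain ⟨p, hp, rfl⟩ := hx
      rw [hΨφ p hp] at hx'
      exact ⟨p, Metric.ball_subset_closedBall hx', rfl⟩
    exact nhdsWithin_le_nhds (hγ.continuous.continuousAt.eventually hnhds)
  obtain ⟨y, hy, hy1⟩ := hmem ⟨zero_le_one, le_rfl⟩
  rw [← hγ1, ← hy1]
  exact hmaps (hsub hy)

end Distance

end IntegralMetric

/-! ### Disks of bounded area project close to the projection of their boundary -/

namespace IntegralMetric

section Disks

open Set

variable {n : ℕ} {Q : Type} [TopologicalSpace Q] [ChartedSpace (EE n) Q] [AffineManifold n Q]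
  {G : IntegralMetric n Q}

local notation "𝔻" => Metric.closedBall (0 : ℂ) 1

theorem lintegral_energyDensity_le {A : ℝ} {hA : 0 < A} {u : ℂ → G.XA}
    (hu : G.IsHolomorphicDisk (G.metricJ A hA) u) {E : ℝ} (hE : G.area u ≤ E) :
    ∫⁻ w in Metric.ball (0 : ℂ) 1, ENNReal.ofReal (A * G.energyDensity u w) ≤
      ENNReal.ofReal (A * E) := by
  have hint : IntegrableOn (G.energyDensity u) 𝔻 :=
    (continuousOn_energyDensity hu.1).integrableOn_compact (isCompact_closedBall 0 1)
  calc ∫⁻ w in Metric.ball (0 : ℂ) 1, ENNReal.ofReal (A * G.energyDensity u w)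
      ≤ ∫⁻ w in 𝔻, ENNReal.ofReal (A * G.energyDensity u w) :=
        lintegral_mono_set Metric.ball_subset_closedBall
    _ = ENNReal.ofReal (∫ w in 𝔻, A * G.energyDensity u w) := by
        refine (ofReal_integral_eq_lintegral_ofReal (hint.const_mul A) ?_).symm
        refine (ae_restrict_iff' measurableSet_closedBall).2 (Filter.Eventually.of_forall ?_)
        exact fun w hw => mul_nonneg hA.le (energyDensity_nonneg hu hw)
    _ ≤ ENNReal.ofReal (A * E) := by
        rw [integral_const_mul]
        exact ENNReal.ofReal_le_ofReal (mul_le_mul_of_nonneg_left hE hA.le)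

/-- The image in the base of a straight segment in the disk is a smooth path, whose speed is
controlled by the energy density. -/
theorem dist_proj_segment_le {A : ℝ} {hA : 0 < A} {u : ℂ → G.XA}
    (hu : G.IsHolomorphicDisk (G.metricJ A hA) u) {z w : ℂ} {R : ℝ} (hw : ‖w‖ = 1) (hR : 0 < R)
    (hseg : ∀ t ∈ Icc 0 R, z + t * w ∈ 𝔻) :
    G.dist (G.proj (u z)) (G.proj (u (z + R * w))) ≤
      ∫⁻ t in Icc 0 R, ENNReal.ofReal √(A⁻¹ * G.energyDensity u (z + t * w)) := by
  set l : ℝ → ℂ := fun t => z + t * w with hl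
  have hld : ∀ t, HasDerivAt l w t := fun t => by
    have h := ((Complex.ofRealCLM.hasDerivAt (x := t)).mul_const w).const_add z
    simpa [hl] using h
  have hlc : ContDiff ℝ 1 l := by
    rw [hl]
    exact contDiff_const.add (Complex.ofRealCLM.contDiff.mul contDiff_const)
  have hmaps : MapsTo l (Icc 0 R) 𝔻 := hseg
  have hc : ContMDiffOn 𝓘(ℝ, ℝ) (𝓡 n) 1 ((fun v => G.proj (u v)) ∘ l) (Icc 0 R) := fun t ht =>
    ((contMDiffWithinAt_proj hu.1 (hseg t ht)).1.of_le (by simp)).comp t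
      hlc.contMDiff.contMDiffAt.contMDiffWithinAt hmaps
  have h := G.dist_le_lintegral hR.le hc
  have h0 : l 0 = z := by simp [hl]
  rw [Function.comp_apply, Function.comp_apply, h0] at h
  refine h.trans (setLIntegral_mono' measurableSet_Icc fun t ht => ?_)
  refine ENNReal.ofReal_le_ofReal (Real.sqrt_le_sqrt ?_)
  have hz := hseg t ht
  have hder : mfderivWithin 𝓘(ℝ, ℝ) (𝓡 n) ((fun v => G.proj (u v)) ∘ l) (Icc 0 R) t (1 : ℝ) =
      (G.diskDeriv u (l t) w).1 := by
    rw [mfderivWithin_comp (I' := 𝓘(ℝ, ℂ)) (u := 𝔻) t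
      ((contMDiffWithinAt_proj hu.1 hz).1.mdifferentiableWithinAt (by simp))
      (hlc.contMDiff.mdifferentiable one_ne_zero t).mdifferentiableWithinAt hmaps
      (uniqueMDiffWithinAt_iff_uniqueDiffWithinAt.2 (uniqueDiffOn_Icc hR t ht)),
      ← (contMDiffWithinAt_proj hu.1 hz).2 w]
    have h1 : mfderivWithin 𝓘(ℝ, ℝ) 𝓘(ℝ, ℂ) l (Icc 0 R) t (1 : ℝ) = w := by
      rw [mfderivWithin_eq_fderivWithin]
      exact (hld t).hasDerivWithinAt.derivWithin (uniqueDiffOn_Icc hR t ht)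
    exact congrArg _ h1
  have hle := flat_diskDeriv_le hu hz w
  rw [hw, one_pow, one_mul] at hle
  rw [Function.comp_apply, hder, le_inv_mul_iff₀ hA]
  exact hle

/-- An `I_A`-holomorphic disk of area at most `E` projects into the neighbourhood of radius
`5 (E / A) ^ (1/2)` of the projection of its boundary. -/
theorem exists_boundary_dist_le {A : ℝ} {hA : 0 < A} {u : ℂ → G.XA}
    (hu : G.IsHolomorphicDisk (G.metricJ A hA) u) {E : ℝ} (hE0 : 0 < E) (hE : G.area u ≤ E)
    {z : ℂ} (hz : ‖z‖ < 1) :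
    ∃ w : ℂ, ‖w‖ = 1 ∧
      G.dist (G.proj (u w)) (G.proj (u z)) ≤ ENNReal.ofReal (A⁻¹ * (5 * √(A * E))) := by
  obtain ⟨F, hFd, hF⟩ := exists_holomorphic_derivative hu
  have hη : 0 < √(A * E) := Real.sqrt_pos.2 (mul_pos hA hE0)
  have henergy : ∫⁻ w in Metric.ball (0 : ℂ) 1, ‖F w‖ₑ ^ 2 ≤ ENNReal.ofReal (√(A * E) ^ 2) := by
    rw [Real.sq_sqrt (mul_pos hA hE0).le]
    refine le_trans (le_of_eq (setLIntegral_congr_fun measurableSet_ball fun w hw => ?_))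
      (lintegral_energyDensity_le hu hE)
    rw [← hF w hw, ← ofReal_norm, ENNReal.ofReal_pow (norm_nonneg _)]
  obtain ⟨w, R, hw, hR, hRw, hseg, hlen⟩ := exists_short_segment hη hFd henergy hz
  refine ⟨z + R * w, hRw, ?_⟩
  rw [dist_comm]
  have hseg' : ∀ t ∈ Icc 0 R, z + t * w ∈ 𝔻 := by
    intro t ht
    rcases ht.2.eq_or_lt with rfl | h
    · exact mem_closedBall_zero_iff.2 hRw.le
    · exact Metric.ball_subset_closedBall (hseg t ⟨ht.1, h⟩)
  calc G.dist (G.proj (u z)) (G.proj (u (z + R * w)))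
      ≤ ∫⁻ t in Icc 0 R, ENNReal.ofReal √(A⁻¹ * G.energyDensity u (z + t * w)) :=
        dist_proj_segment_le hu hw hR hseg'
    _ = ∫⁻ t in Ioo 0 R, ENNReal.ofReal √(A⁻¹ * G.energyDensity u (z + t * w)) :=
        setLIntegral_congr Ioo_ae_eq_Icc.symm
    _ = ∫⁻ t in Ioo 0 R, ENNReal.ofReal A⁻¹ * ‖F (z + t * w)‖ₑ := by
        refine setLIntegral_congr_fun measurableSet_Ioo fun t ht => ?_
        have h : A⁻¹ * G.energyDensity u (z + t * w) = (A⁻¹ * ‖F (z + t * w)‖) ^ 2 := by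
          rw [mul_pow, hF _ (hseg t ⟨ht.1.le, ht.2⟩)]
          field_simp
        rw [h, Real.sqrt_sq (by positivity), ENNReal.ofReal_mul (inv_nonneg.2 hA.le), ofReal_norm]
    _ = ENNReal.ofReal A⁻¹ * ∫⁻ t in Ioo 0 R, ‖F (z + t * w)‖ₑ :=
        lintegral_const_mul' _ _ ENNReal.ofReal_ne_top
    _ ≤ ENNReal.ofReal A⁻¹ * ENNReal.ofReal (5 * √(A * E)) := by gcongr
    _ = ENNReal.ofReal (A⁻¹ * (5 * √(A * E))) :=
        (ENNReal.ofReal_mul (inv_nonneg.2 hA.le)).symm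

end Disks

end IntegralMetric

/-! ### Vanishing of the boundary classes -/

section Vanishing

variable {n : ℕ} {Q : Type} [TopologicalSpace Q] [ChartedSpace (EE n) Q] [AffineManifold n Q]
  {G : IntegralMetric n Q} {V : TropicalSubvariety G} {ε : ℝ} {L : Set G.XA}

/-- Both hypotheses on the lift give a uniform radius: points of the base within `ρ` of the
projection of the lift remain in the neighbourhood of the tropical subvariety. -/
theorem IsLagrangianLift.exists_uniform [T2Space Q] (hL : IsLagrangianLift G V ε L)
    (hunif : IsCompact L ∨
      ∃ ρ : ℝ, 0 < ρ ∧ ∀ x ∈ L, G.HasFlatBall (G.proj x) ρ (G.thickening V.support ε)) :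
    ∃ ρ : ℝ, 0 < ρ ∧ ∀ x ∈ L, ∀ q, G.dist (G.proj x) q < ENNReal.ofReal ρ →
      q ∈ G.thickening V.support ε := by
  rcases hunif with hK | ⟨ρ, hρ, h⟩
  · obtain ⟨ρ, hρ, h⟩ := G.exists_uniform_of_isCompact (hK.image G.continuous_proj)
      (Set.image_subset_iff.2 hL.2)
    exact ⟨ρ, hρ, fun x hx => h _ (Set.mem_image_of_mem _ hx)⟩
  · exact ⟨ρ, hρ, fun x hx q => (h x hx).mem_of_dist_lt⟩

/-- If a disk projects into the neighbourhood of the tropical subvariety, its boundary is trivial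
in the homology of the tropical subvariety. -/
theorem H1map_piV_eq_zero (hL : IsLagrangianLift G V ε L)
    (h : ContinuousMap.HomotopyEquiv V.support (G.thickening V.support ε)) {u : ℂ → G.XA}
    (hu : G.IsSmoothDisk u)
    (hmaps : ∀ z ∈ Metric.closedBall (0 : ℂ) 1, G.proj (u z) ∈ G.thickening V.support ε)
    (γ : C(Circle, L)) (hγ : ∀ z : Circle, (γ z : G.XA) = u z) (c : H1 Circle) :
    H1map (piV hL h) (H1map γ c) = 0 := by
  let k : C(Metric.closedBall (0 : ℂ) 1, G.thickening V.support ε) :=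
    ⟨fun z => ⟨G.proj (u z), hmaps z z.2⟩, by
      have hc : ContinuousOn (fun z => G.proj (u z)) (Metric.closedBall (0 : ℂ) 1) := fun z hz =>
        (IntegralMetric.contMDiffWithinAt_proj hu hz).1.continuousWithinAt
      exact (continuousOn_iff_continuous_domRestrict.1 hc).subtype_mk _⟩
  let i : C(Circle, Metric.closedBall (0 : ℂ) 1) :=
    ⟨fun z => ⟨z, mem_closedBall_zero_iff.2 z.norm_coe.le⟩, continuous_subtype_val.subtype_mk _⟩
  have : ContractibleSpace (Metric.closedBall (0 : ℂ) 1) :=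
    (convex_closedBall (0 : ℂ) 1).contractibleSpace ⟨0, by simp⟩
  have heq : (piV hL h).comp γ = (h.invFun.comp k).comp i := by
    ext1 z
    refine congrArg h.invFun (Subtype.ext ?_)
    exact congrArg G.proj (hγ z)
  rw [← H1map_comp, heq, H1map_comp_eq_zero]

/-- The choice of `A` for which `I_A`-holomorphic disks of area at most `E` project into the
`ρ`-neighbourhood of the projection of their boundary. -/
theorem inv_mul_sqrt_lt {ρ E : ℝ} (hρ : 0 < ρ) (hE : 0 < E) :
    (25 * E / ρ ^ 2 + 1)⁻¹ * (5 * √((25 * E / ρ ^ 2 + 1) * E)) < ρ := by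
  set A := 25 * E / ρ ^ 2 + 1 with hAdef
  have hA : 0 < A := by positivity
  have hAE : 25 * E < A * ρ ^ 2 := by
    rw [hAdef, add_mul, div_mul_cancel₀ _ (by positivity)]
    nlinarith [pow_pos hρ 2]
  rw [inv_mul_lt_iff₀ hA]
  refine lt_of_pow_lt_pow_left₀ 2 (by positivity) ?_
  rw [mul_pow, Real.sq_sqrt (by positivity)]
  nlinarith [mul_lt_mul_of_pos_left hAE hA]

end Vanishing

end Trop

end

theorem mainTheorem4 {n : ℕ} {Q : Type} [TopologicalSpace Q] [T2Space Q]
    [SecondCountableTopology Q] [ChartedSpace (Trop.EE n) Q] [Trop.AffineManifold n Q]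
    (G : Trop.IntegralMetric n Q) (V : Trop.TropicalSubvariety G)
    (ε : ℝ) (hε : 0 < ε)
    (h : ContinuousMap.HomotopyEquiv V.support (G.thickening V.support ε))
    (hincl : ∀ x : V.support, (h x : Q) = x)
    (L : Set G.XA) (hL : Trop.IsLagrangianLift G V ε L)
    (hunif : IsCompact L ∨
      ∃ ρ : ℝ, 0 < ρ ∧ ∀ x ∈ L, G.HasFlatBall (G.proj x) ρ (G.thickening V.support ε)) :
    ∃ J : ℝ → G.CompatibleJ,
      (∀ E : ℝ, 0 < E → ∃ (A : ℝ) (hA : 0 < A), J E = G.metricJ A hA) ∧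
      G.limitLoopGrading L J ≤ LinearMap.ker (Trop.H1map (Trop.piV hL h)) := by
  obtain ⟨ρ, hρ, hunif'⟩ := hL.exists_uniform hunif
  -- only positive `E` matter; the absolute value makes the parameter positive for all `E`
  have hpos : ∀ E : ℝ, 0 < 25 * |E| / ρ ^ 2 + 1 := fun E => by positivity
  refine ⟨fun E => G.metricJ (25 * |E| / ρ ^ 2 + 1) (hpos E),
    fun E _ => ⟨_, hpos E, rfl⟩, Submodule.span_le.2 ?_⟩
  rintro _ ⟨E, u, γ, c, hE, hu, harea, hγ, rfl⟩
  have hbd : ∀ w : ℂ, ‖w‖ = 1 → u w ∈ L := fun w hw => by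
    have h1 := hγ ⟨w, mem_sphere_zero_iff_norm.2 hw⟩
    rw [← show (γ ⟨w, mem_sphere_zero_iff_norm.2 hw⟩ : G.XA) = u w from h1]
    exact (γ _).2
  refine LinearMap.mem_ker.2 (Trop.H1map_piV_eq_zero hL h hu.1 (fun z hz => ?_) γ hγ c)
  rcases (mem_closedBall_zero_iff.1 hz).eq_or_lt with hz1 | hz1
  · exact hL.2 _ (hbd z hz1)
  obtain ⟨w, hw, hdist⟩ := Trop.IntegralMetric.exists_boundary_dist_le hu hE harea hz1
  refine hunif' (u w) (hbd w hw) _ (hdist.trans_lt ?_)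
  rw [abs_of_pos hE]
  exact (ENNReal.ofReal_lt_ofReal_iff hρ).2 (Trop.inv_mul_sqrt_lt hρ hE)
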